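/- **Setting.** Fix $m\ge 0$, proportions $0<\theta_1<\dots<\theta_m<1$, means $\mu_1,\dots,\mu_{m+1}$ with $\mu_k\ne\mu_{k+1}$, and i.i.d. centred Gaussian variables $\epsilon_1,\epsilon_2,\dots$ of variance $\sigma^2>0$. For a series of length $n$ put $\tau_k=\lfloor\theta_k n\rfloor$, $\tau_0=0$, $\tau_{m+1}=n$, and let $y_i=\mu_k+\epsilon_i$ for $\tau_{k-1}<i\le\tau_k$. For data $y_{a+1:e}$ and a set $\mathcal B$ of points, $PELT(y_{a+1:e},\mathcal B)$ is the output of the PELT algorithm (optimal-partitioning recursion over the points of $\mathcal B$ with inequality-based pruning), which minimises $\sum_j[\mathcal C(y_{\tau'_{j-1}+1:\tau'_j})+\beta]$ over segmentations of $y_{a+1:e}$ with all changepoints in $\mathcal B\cap\{a+1,\dots,e-1\}$, where $\mathcal C(y_{s:t})=\sum_{i=s}^t(y_i-\bar y_{s:t})^2$. The penalty is $\beta=(2+\varepsilon)\sigma^2\log n$ with $\varepsilon>0$ fixed; it is the same on all cores. Let $L=L(n)\ge1$ be the number of cores and $q=\lfloor n/L\rfloor$. * **Chunk** with overlap $V=V(n)\ge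 0$: core $i$ computes $\hat{\boldsymbol\tau}_i=PELT(y_{\mathcal B_i},\mathcal B_i)$, where $\mathcal B_i=\{(i-1)q-V,\dots,iq+V\}\cap\{1,\dots,n\}$ for $1\le i<L$ and $\mathcal B_L=\{(L-1)q-V,\dots,n\}\cap\{1,\dots,n\}$. * **Deal**: core $i$ computes $\hat{\boldsymbol\tau}_i=PELT(y_{1:n},\mathcal B_i)$, where $\mathcal B_i=\{x\in\{1,\dots,n-1\}: x\equiv i \bmod L\}$, $1\le i\le L$. In both procedures the parent core then sorts $\bigcup_i\hat{\boldsymbol\tau}_i$ (by insertion sort) and returns $PELT(y_{1:n},\bigcup_i\hat{\boldsymbol\tau}_i)$. The cost of a procedure is the number of segment-cost evaluations, arithmetic operations and comparisons carried out by the slowest core in the split phase, plus the number of those carried out by the parent core in the merge phase (sorting included). Evaluating one $\mathcal C(y_{s:t})$ counts as one operation, and setting up the parallel environment and communicating are free. **Claim.** Let $L(n)=o(n)$. 1. (Chunk) Suppose $2V(n)\le\lfloor n/L(n)\rfloor$ for all large $n$. Then, with probability tending to $1$ as $n\to\infty$, all cores together return at most $2m$ candidates: $\sum_i|\hat{\boldsymbol\tau}_i|\le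 2m$. If moreover the number $n-L(n)\lfloor n/L(n)\rfloor$ of left-over points, which go to the last core, is at most $K\,n/L(n)$ for all large $n$, then with probability tending to $1$ the cost of Chunk is at most $C\max\left(\left(\frac n{L(n)}\right)^2,m^2\right)$, where the constant $C$ depends only on $K$. 2. (Deal) Suppose that for some $\alpha>0$ we have $L(n)\ge\lceil(\log n)^{1+\alpha}\rceil$ for all large $n$. Then, with probability tending to $1$, every core returns at most $2m$ candidates, and with probability tending to $1$ the cost of Deal is at most $C\max\left(\left(\frac n{L(n)}\right)^2,L(n)^2\right)$, where the constant $C$ depends only on $m$. 3. (PELT) The cost of $PELT(y_{1:n},\{1,\dots,n-1\})$ without parallelisation is at most $Cn^2$ for an absolute constant $C$, all $n\ge1$, all data and all penalties. -/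

import Mathlib

open MeasureTheory ProbabilityTheory Filter Topology Asymptotics
open scoped NNReal ENNReal

namespace ParSpeed

/-! ### Programs with a step count -/

/-- A value together with the number of elementary operations spent on computing it. -/
structure Timed (α : Type) where
  val : α
  steps : ℕ

namespace Timed

/-- Spend `k` elementary operations on obtaining `a`. -/
def tick {α : Type} (k : ℕ) (a : α) : Timed α := ⟨a, k⟩

/-- Sequential composition adds the step counts; returning a value is free. -/
instance : Monad Timed where
  pure a := ⟨a, 0⟩
  bind x f := ⟨(f x.val).val, x.steps + (f x.val).steps⟩

end Timed

/-! ### PELT for the squared error loss -/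

noncomputable section

/-- The quadratic error loss of the segment `y_{s+1}, …, y_t`. -/
def segCost (y : ℕ → ℝ) (s t : ℕ) : ℝ :=
  ∑ i ∈ Finset.Ioc s t, (y i - (∑ j ∈ Finset.Ioc s t, y j) / (t - s : ℝ)) ^ 2

/-- A candidate for the most recent changepoint: its location `t`, the optimal penalised cost `F t`
of the data up to `t`, and the changepoints of an optimal segmentation of these data followed by
`t` itself, the latest first (empty for the starting point, which is not a changepoint). -/
structure Cand where
  loc : ℕ
  F : ℝ
  cps : List ℕ

/-- `F t + C(y_{t+1:s})` for the candidate `t`. An evaluation of a segment cost (a constant number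
of operations once cumulative sums are at hand) and the addition are counted. -/
def evalCand (y : ℕ → ℝ) (s : ℕ) (c : Cand) : Timed (ℝ × Cand) :=
  Timed.tick 2 (c.F + segCost y c.loc s, c)

/-- `evalCand` for all candidates of a list. -/
def evalAll (y : ℕ → ℝ) (s : ℕ) : List Cand → Timed (List (ℝ × Cand))
  | [] => pure []
  | c :: R => do
    let x ← evalCand y s c
    let xs ← evalAll y s R
    pure (x :: xs)

/-- A minimiser by linear search; every comparison is counted. -/
def argminScan (best : ℝ × Cand) : List (ℝ × Cand) → Timed (ℝ × Cand)
  | [] => pure best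
  | x :: xs => do
    let b ← Timed.tick 1 (if x.1 < best.1 then x else best)
    argminScan b xs

/-- The pruning step: keep the candidates `t` with `F t + C(y_{t+1:s}) ≤ F s`; every comparison is
counted. -/
def prune (f : ℝ) : List (ℝ × Cand) → Timed (List Cand)
  | [] => pure []
  | x :: xs => do
    let r ← prune f xs
    Timed.tick 1 (if x.1 ≤ f then x.2 :: r else r)

/-- One iteration of PELT, at the point `s`. The current set of candidates is given as its newest
member and the list of the others. -/
def peltStep (y : ℕ → ℝ) (β : ℝ) (R : Cand × List Cand) (s : ℕ) : Timed (Cand × List Cand) := do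
  let x ← evalCand y s R.1
  let xs ← evalAll y s R.2
  let b ← argminScan x xs
  let c ← Timed.tick 1 (⟨s, b.1 + β, s :: b.2.cps⟩ : Cand)
  let r ← prune c.F (x :: xs)
  pure (c, r)

/-- The iterations of PELT over an increasing list of points. -/
def peltLoop (y : ℕ → ℝ) (β : ℝ) : Cand × List Cand → List ℕ → Timed (Cand × List Cand)
  | R, [] => pure R
  | R, s :: B => do
    let R' ← peltStep y β R s
    peltLoop y β R' B

/-- `PELT(y_{a+1:e}, B)` with penalty `β` per segment: the changepoints (in increasing order) of a
segmentation of `y_{a+1}, …, y_e` of least penalised cost among those with changepoints in the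
increasing list `B`. A changepoint `τ` means a change between `τ` and `τ + 1`, so that `e` itself is
not one. -/
def pelt (y : ℕ → ℝ) (β : ℝ) (a e : ℕ) (B : List ℕ) : Timed (List ℕ) := do
  let R ← peltLoop y β (⟨a, 0, []⟩, []) (B.filter fun b => a < b ∧ b < e)
  let x ← evalCand y e R.1
  let xs ← evalAll y e R.2
  let b ← argminScan x xs
  Timed.tick b.2.cps.length b.2.cps.reverse

/-- PELT on all the data `y_1, …, y_n`, without parallelisation. -/
def plainPelt (y : ℕ → ℝ) (β : ℝ) (n : ℕ) : Timed (List ℕ) :=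
  pelt y β 0 n (List.range' 1 (n - 1))

/-! ### Parallelisation over `L` cores -/

/-- Insertion into an increasing list without repetitions; every comparison is counted. -/
def insertSorted (x : ℕ) : List ℕ → Timed (List ℕ)
  | [] => pure [x]
  | z :: zs => do
    let first ← Timed.tick 1 (decide (x < z))
    if first then pure (x :: z :: zs)
    else do
      let same ← Timed.tick 1 (decide (x = z))
      if same then pure (z :: zs)
      else do
        let r ← insertSorted x zs
        pure (z :: r)

/-- Insertion sort with removal of repetitions. -/
def sortUnion : List ℕ → Timed (List ℕ)
  | [] => pure []
  | x :: xs => do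
    let r ← sortUnion xs
    insertSorted x r

/-- What the cores `1, …, L` return, listed one after the other. -/
def candidates (L : ℕ) (core : ℕ → Timed (List ℕ)) : List ℕ :=
  (List.range' 1 L).flatMap fun i => (core i).val

/-- The parent core sorts the returned candidates and applies PELT to `y_{1:n}` with them. -/
def merge (y : ℕ → ℝ) (β : ℝ) (n : ℕ) (cs : List ℕ) : Timed (List ℕ) := do
  let B ← sortUnion cs
  pelt y β 0 n B

/-- Split phase and merge phase. The cores work simultaneously, so that the split phase takes as
long as its slowest core; communication with the cores is free. -/
def parallelise (y : ℕ → ℝ) (β : ℝ) (n L : ℕ) (core : ℕ → Timed (List ℕ)) : Timed (List ℕ) := do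
  let cs ← Timed.tick ((Finset.Icc 1 L).sup fun i => (core i).steps) (candidates L core)
  merge y β n cs

/-- First point of the `i`-th chunk, for `1 ≤ i ≤ L`. -/
def chunkLo (n L V i : ℕ) : ℕ := max 1 ((i - 1) * (n / L) - V)

/-- Last point of the `i`-th chunk, for `1 ≤ i ≤ L`. -/
def chunkHi (n L V i : ℕ) : ℕ := if i = L then n else min n (i * (n / L) + V)

/-- The `i`-th chunk, as an increasing list. -/
def chunkSet (n L V i : ℕ) : List ℕ :=
  List.range' (chunkLo n L V i) (chunkHi n L V i + 1 - chunkLo n L V i)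

/-- The `i`-th core under Chunk applies PELT to the data in its chunk. -/
def chunkCore (y : ℕ → ℝ) (β : ℝ) (n L V i : ℕ) : Timed (List ℕ) :=
  pelt y β (chunkLo n L V i - 1) (chunkHi n L V i) (chunkSet n L V i)

/-- The Chunk procedure with `L` cores and overlap `V`. -/
def chunk (y : ℕ → ℝ) (β : ℝ) (n L V : ℕ) : Timed (List ℕ) :=
  parallelise y β n L (chunkCore y β n L V)

/-- The points of `{1, …, n - 1}` that are dealt to the `i`-th core. -/
def dealSet (n L i : ℕ) : List ℕ :=
  (List.range' 1 (n - 1)).filter fun x => x % L = i % L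

/-- The `i`-th core under Deal applies PELT to all the data, with the candidates dealt to it. -/
def dealCore (y : ℕ → ℝ) (β : ℝ) (n L i : ℕ) : Timed (List ℕ) :=
  pelt y β 0 n (dealSet n L i)

/-- The Deal procedure with `L` cores. -/
def deal (y : ℕ → ℝ) (β : ℝ) (n L : ℕ) : Timed (List ℕ) :=
  parallelise y β n L (dealCore y β n L)

/-! ### The change in mean setting -/

/-- The true changepoints `⌊θ_j n⌋`. -/
def trueChange {m : ℕ} (θ : Fin m → ℝ) (n : ℕ) (j : Fin m) : ℕ := ⌊θ j * n⌋₊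

/-- The segment of the time point `i`, as the number of true changepoints before it. -/
def segIndex {m : ℕ} (θ : Fin m → ℝ) (n i : ℕ) : Fin (m + 1) :=
  ⟨(Finset.univ.filter fun j => trueChange θ n j < i).card,
    Nat.lt_succ_of_le ((Finset.card_filter_le _ _).trans (by simp))⟩

/-- The time series `y_1, …, y_n`: segment mean plus noise. -/
def series {Ω : Type*} {m : ℕ} (θ : Fin m → ℝ) (μ : Fin (m + 1) → ℝ) (Z : ℕ → Ω → ℝ)
    (n : ℕ) (ω : Ω) (i : ℕ) : ℝ :=
  μ (segIndex θ n i) + Z i ω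

/-- The change in mean setting: fixed proportions `0 < θ_1 < … < θ_m < 1`, different means on
adjacent segments, and i.i.d. centred Gaussian noise of variance `v > 0`. -/
structure ChangeInMean {Ω : Type*} [MeasurableSpace Ω] (P : Measure Ω) {m : ℕ}
    (θ : Fin m → ℝ) (μ : Fin (m + 1) → ℝ) (v : ℝ≥0) (Z : ℕ → Ω → ℝ) : Prop where
  strictMono : StrictMono θ
  mem_Ioo : ∀ j, θ j ∈ Set.Ioo (0 : ℝ) 1
  jump : ∀ k : Fin m, μ k.castSucc ≠ μ k.succ
  var_pos : 0 < v
  law : ∀ i, HasLaw (Z i) (gaussianReal 0 v) P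
  indep : iIndepFun Z P

/-- The penalty `(2 + ε) σ² log n` for noise of variance `σ² = v`. -/
def penalty (ε : ℝ) (v : ℝ≥0) (n : ℕ) : ℝ := (2 + ε) * v * Real.log n

end

end ParSpeed

namespace ParSpeed

/-! ### Step counts -/

/-! The costs follow from deterministic counting once the numbers of returned candidates are known.
Pruning can only shorten the candidate set of PELT, which grows by at most one per point, so PELT
over a list `B` takes at most `8 (|B| + 1) ^ 2` steps whatever the data (`pelt_steps_le`); sorting
is quadratic too. It remains to bound the number of changepoints in the output of each core. Since
pruning never loses an optimum (`pelt_optimal`), this output is a segmentation of least penalised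
cost over the admissible points, and only that is used.

For Deal, deleting a changepoint leaves an admissible segmentation, so by optimality each
changepoint gains at least the penalty over the stretch between its two neighbours. With high
probability no split of pure noise gains that much, so the stretch contains a true change. A true
change can serve at most two changepoints, one on each side, which gives `2 m` for every core
(`IsOptimal.length_le_two_mul`).

For Chunk, the total over all cores is at most `2 m` if a core returns no more changepoints than its
chunk contains changes, as each change lies in at most two chunks (`card_chunksAt_le`). This sharper
bound (`IsOptimal.length_le_card`) compares the optimum with the segmentation at the true changes.
Passing from the former to the latter loses little on a homogeneous stretch when every piece has an
endpoint from which the noise sums are `Tame`. The exceptional stretches hold two changepoints far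
from all changes; each costs at most one gain `G`, less than the penalty, and they are outnumbered
by the excess changepoints because nearly every true change has a changepoint of its own close by
(`IsOptimal.exists_near`).

The probabilistic input is the event `Typical`. The gain of a split of noise is a squared centred
Gaussian of variance `σ²`. Grouping the two arms of the split into geometric scales, applying Lévy's
maximal inequality to both arms and taking a union over the `n` split points bounds all gains by `(2
+ ε / 2) σ² log n`, below the penalty (`IsNoise.measure_gain_le`). Tameness with the much smaller
bound `δ σ² log n` holds only at few prescribed points, with failure probability a negative power of
`n` at each; the required `anchors` number `O(log n)`. -/

@[simp] lemma Timed.bind_val {α β : Type} (x : Timed α) (f : α → Timed β) :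
    (x >>= f).val = (f x.val).val := rfl

@[simp] lemma Timed.bind_steps {α β : Type} (x : Timed α) (f : α → Timed β) :
    (x >>= f).steps = x.steps + (f x.val).steps := rfl

@[simp] lemma Timed.pure_val {α : Type} (a : α) : (pure a : Timed α).val = a := rfl

@[simp] lemma Timed.pure_steps {α : Type} (a : α) : (pure a : Timed α).steps = 0 := rfl

@[simp] lemma Timed.tick_val {α : Type} (k : ℕ) (a : α) : (Timed.tick k a).val = a := rfl

@[simp] lemma Timed.tick_steps {α : Type} (k : ℕ) (a : α) : (Timed.tick k a).steps = k := rfl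

lemma evalAll_val (y : ℕ → ℝ) (s : ℕ) (R : List Cand) :
    (evalAll y s R).val = R.map fun c => (c.F + segCost y c.loc s, c) := by
  induction R with
  | nil => rfl
  | cons c R ih => simp [evalAll, evalCand, ih]

lemma evalAll_steps (y : ℕ → ℝ) (s : ℕ) (R : List Cand) :
    (evalAll y s R).steps = 2 * R.length := by
  induction R with
  | nil => rfl
  | cons c R ih => simp [evalAll, evalCand, ih]; ring

lemma argminScan_steps (b : ℝ × Cand) (xs : List (ℝ × Cand)) :
    (argminScan b xs).steps = xs.length := by
  induction xs generalizing b with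
  | nil => rfl
  | cons x xs ih => simp [argminScan, ih]; ring

lemma argminScan_mem (b : ℝ × Cand) (xs : List (ℝ × Cand)) :
    (argminScan b xs).val ∈ b :: xs := by
  induction xs generalizing b with
  | nil => simp [argminScan]
  | cons x xs ih =>
    simp only [argminScan, Timed.bind_val, Timed.tick_val]
    have := ih (if x.1 < b.1 then x else b)
    split_ifs at this ⊢ <;> simp only [List.mem_cons] at this ⊢ <;> tauto

lemma argminScan_le (b : ℝ × Cand) (xs : List (ℝ × Cand)) :
    ∀ x ∈ b :: xs, (argminScan b xs).val.1 ≤ x.1 := by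
  induction xs generalizing b with
  | nil => simp [argminScan]
  | cons z xs ih =>
    simp only [argminScan, Timed.bind_val, Timed.tick_val]
    have := ih (if z.1 < b.1 then z else b)
    split_ifs at this ⊢ with h <;> simp only [List.mem_cons, forall_eq_or_imp] at this ⊢
    · exact ⟨by linarith, this.1, this.2⟩
    · exact ⟨this.1, by linarith, this.2⟩

lemma prune_val (f : ℝ) (xs : List (ℝ × Cand)) :
    (prune f xs).val = (xs.filter fun x => x.1 ≤ f).map Prod.snd := by
  induction xs with
  | nil => rfl
  | cons x xs ih =>
    by_cases h : x.1 ≤ f <;>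
      simp [prune, ih, h]

lemma prune_steps (f : ℝ) (xs : List (ℝ × Cand)) : (prune f xs).steps = xs.length := by
  induction xs with
  | nil => rfl
  | cons x xs ih => simp [prune, ih]

lemma peltStep_steps (y : ℕ → ℝ) (β : ℝ) (R : Cand × List Cand) (s : ℕ) :
    (peltStep y β R s).steps = 4 * R.2.length + 4 := by
  simp [peltStep, evalCand, evalAll_steps, argminScan_steps, prune_steps, evalAll_val]
  ring

lemma peltStep_length (y : ℕ → ℝ) (β : ℝ) (R : Cand × List Cand) (s : ℕ) :
    (peltStep y β R s).val.2.length ≤ R.2.length + 1 := by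
  simp only [peltStep, Timed.bind_val, Timed.pure_val, prune_val, List.length_map]
  exact (List.length_filter_le _ _).trans (by simp [evalAll_val])

lemma peltStep_cps_length (y : ℕ → ℝ) (β : ℝ) (R : Cand × List Cand) (s k : ℕ)
    (h : ∀ c ∈ R.1 :: R.2, c.cps.length ≤ k) :
    ∀ c ∈ (peltStep y β R s).val.1 :: (peltStep y β R s).val.2, c.cps.length ≤ k + 1 := by
  have key : ∀ x ∈ (evalCand y s R.1).val :: (evalAll y s R.2).val, x.2.cps.length ≤ k := by
    intro x hx
    simp only [evalCand, evalAll_val, Timed.tick_val, List.mem_cons, List.mem_map] at hx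
    rcases hx with rfl | ⟨c, hc, rfl⟩
    · exact h _ (by simp)
    · exact h _ (by simp [hc])
  simp only [peltStep, Timed.bind_val, Timed.pure_val, Timed.tick_val, prune_val]
  intro c hc
  rcases List.mem_cons.1 hc with rfl | hc
  · have := key _ (argminScan_mem (evalCand y s R.1).val (evalAll y s R.2).val)
    simpa using this
  · obtain ⟨x, hx, rfl⟩ := List.mem_map.1 hc
    exact (key x (List.mem_of_mem_filter hx)).trans (by omega)

/-- Each iteration adds one candidate and one changepoint at most, and costs four operations per
candidate. No benefit from pruning is assumed, hence the quadratic bound for all data. -/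
lemma peltLoop_bounds (y : ℕ → ℝ) (β : ℝ) (B : List ℕ) (R : Cand × List Cand) (k : ℕ)
    (h : ∀ c ∈ R.1 :: R.2, c.cps.length ≤ k) :
    (peltLoop y β R B).steps ≤ 4 * B.length * (R.2.length + B.length + 1) ∧
    (peltLoop y β R B).val.2.length ≤ R.2.length + B.length ∧
    ∀ c ∈ (peltLoop y β R B).val.1 :: (peltLoop y β R B).val.2, c.cps.length ≤ k + B.length := by
  induction B generalizing R k with
  | nil => simpa [peltLoop] using h
  | cons s B ih =>
    obtain ⟨h1, h2, h3⟩ := ih _ _ (peltStep_cps_length y β R s k h)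
    have hl := peltStep_length y β R s
    refine ⟨?_, ?_, ?_⟩
    · simp only [peltLoop, Timed.bind_steps, peltStep_steps, List.length_cons]
      calc _ ≤ 4 * R.2.length + 4 + 4 * B.length * (R.2.length + 1 + B.length + 1) := by
            gcongr; exact h1.trans (by gcongr)
        _ ≤ _ := by nlinarith
    · simp only [peltLoop, Timed.bind_val, List.length_cons]; omega
    · simp only [peltLoop, Timed.bind_val, List.length_cons]
      intro c hc
      exact (h3 c hc).trans (by omega)

lemma pelt_steps_le (y : ℕ → ℝ) (β : ℝ) (a e : ℕ) (B : List ℕ) :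
    (pelt y β a e B).steps ≤ 8 * (B.length + 1) ^ 2 := by
  set B' := B.filter fun b => a < b ∧ b < e
  have hB : B'.length ≤ B.length := List.length_filter_le _ _
  obtain ⟨h1, h2, h3⟩ := peltLoop_bounds y β B' (⟨a, 0, []⟩, []) 0 (by simp)
  set R := peltLoop y β (⟨a, 0, []⟩, []) B'
  have h4 : (argminScan (evalCand y e R.val.1).val (evalAll y e R.val.2).val).val.2.cps.length
      ≤ B'.length := by
    have := argminScan_mem (evalCand y e R.val.1).val (evalAll y e R.val.2).val
    generalize (argminScan (evalCand y e R.val.1).val (evalAll y e R.val.2).val).val = x at this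
    simp only [evalCand, evalAll_val, Timed.tick_val, List.mem_cons, List.mem_map] at this
    rcases this with rfl | ⟨c, hc, rfl⟩
    · simpa using h3 _ (by simp)
    · simpa using h3 c (by simp [hc])
  have : (pelt y β a e B).steps = R.steps + (2 + (2 * R.val.2.length + (R.val.2.length +
      (argminScan (evalCand y e R.val.1).val (evalAll y e R.val.2).val).val.2.cps.length))) := by
    simp [pelt, evalAll_steps, argminScan_steps, evalAll_val, evalCand, R, B']
  rw [this]
  simp only [List.length_nil, zero_add] at h1 h2
  have h5 : R.steps ≤ 4 * B.length * (B.length + 1) := h1.trans (by gcongr)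
  nlinarith

lemma insertSorted_bounds (x : ℕ) (l : List ℕ) :
    (insertSorted x l).steps ≤ 2 * l.length ∧ (insertSorted x l).val.length ≤ l.length + 1 := by
  induction l with
  | nil => simp [insertSorted]
  | cons z zs ih =>
    by_cases h1 : x < z
    · simp [insertSorted, h1]; omega
    by_cases h2 : x = z
    · simp [insertSorted, h2]
    simp only [insertSorted, Timed.bind_steps, Timed.bind_val, Timed.tick_val, Timed.tick_steps,
      h1, h2, decide_false, Bool.false_eq_true, if_false, Timed.pure_val, Timed.pure_steps,
      List.length_cons]
    omega

lemma sortUnion_bounds (l : List ℕ) :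
    (sortUnion l).steps ≤ 2 * l.length ^ 2 ∧ (sortUnion l).val.length ≤ l.length := by
  induction l with
  | nil => simp [sortUnion]
  | cons x xs ih =>
    have := insertSorted_bounds x (sortUnion xs).val
    simp only [sortUnion, Timed.bind_steps, Timed.bind_val, List.length_cons]
    constructor
    · nlinarith
    · omega

lemma merge_steps_le (y : ℕ → ℝ) (β : ℝ) (n : ℕ) (cs : List ℕ) :
    (merge y β n cs).steps ≤ 10 * (cs.length + 1) ^ 2 := by
  have h := sortUnion_bounds cs
  have h1 := pelt_steps_le y β 0 n (sortUnion cs).val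
  have h2 : ((sortUnion cs).val.length + 1) ^ 2 ≤ (cs.length + 1) ^ 2 := by gcongr; exact h.2
  simp only [merge, Timed.bind_steps]
  nlinarith

lemma parallelise_steps_le (y : ℕ → ℝ) (β : ℝ) (n L : ℕ) (core : ℕ → Timed (List ℕ)) (N : ℕ)
    (hN : ∀ i ∈ Finset.Icc 1 L, (core i).steps ≤ N) :
    (parallelise y β n L core).steps ≤ N + 10 * ((candidates L core).length + 1) ^ 2 := by
  simp only [parallelise, Timed.bind_steps, Timed.tick_steps, Timed.tick_val]
  exact add_le_add (Finset.sup_le hN) (merge_steps_le _ _ _ _)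

lemma plainPelt_steps_le (y : ℕ → ℝ) (β : ℝ) (n : ℕ) (hn : 1 ≤ n) :
    ((plainPelt y β n).steps : ℝ) ≤ 8 * (n : ℝ) ^ 2 := by
  have := pelt_steps_le y β 0 n (List.range' 1 (n - 1))
  rw [List.length_range', Nat.sub_add_cancel hn] at this
  exact_mod_cast this

/-! ### Penalised cost of a segmentation -/

/-- Cost of the segmentation of `y_{a+1}, …, y_e` with changepoints `T`. -/
noncomputable def segmCost (y : ℕ → ℝ) : ℕ → List ℕ → ℕ → ℝ
  | a, [], e => segCost y a e
  | a, t :: T, e => segCost y a t + segmCost y t T e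

/-- Penalised cost of the segmentation of `y_{a+1}, …, y_e` with changepoints `T`. -/
noncomputable def penCost (y : ℕ → ℝ) (β : ℝ) (a : ℕ) (T : List ℕ) (e : ℕ) : ℝ :=
  segmCost y a T e + β * T.length

lemma segmCost_append_cons (y : ℕ → ℝ) (a t e : ℕ) (T₁ T₂ : List ℕ) :
    segmCost y a (T₁ ++ t :: T₂) e = segmCost y a T₁ t + segmCost y t T₂ e := by
  induction T₁ generalizing a with
  | nil => rfl
  | cons u T₁ ih => simp [segmCost, ih]; ring

lemma penCost_concat (y : ℕ → ℝ) (β : ℝ) (a t e : ℕ) (T : List ℕ) :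
    penCost y β a (T ++ [t]) e = penCost y β a T t + β + segCost y t e := by
  simp [penCost, segmCost_append_cons, segmCost]; ring

/-- Sum of squares about the mean, in expanded form. -/
lemma segCost_eq (y : ℕ → ℝ) {s t : ℕ} (h : s < t) :
    segCost y s t = ∑ i ∈ Finset.Ioc s t, y i ^ 2
      - (∑ i ∈ Finset.Ioc s t, y i) ^ 2 / (t - s : ℝ) := by
  have hpos : (0 : ℝ) < (t : ℝ) - s := by
    have : (s : ℝ) < t := by exact_mod_cast h
    linarith
  have hcard : ((Finset.Ioc s t).card : ℝ) = (t : ℝ) - s := by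
    rw [Nat.card_Ioc, Nat.cast_sub h.le]
  unfold segCost
  simp_rw [sub_sq, Finset.sum_add_distrib, Finset.sum_sub_distrib, Finset.sum_const,
    nsmul_eq_mul, hcard, ← Finset.sum_mul, ← Finset.mul_sum]
  field_simp
  ring

@[simp] lemma segCost_self (y : ℕ → ℝ) (s : ℕ) : segCost y s s = 0 := by simp [segCost]

/-- Reduction of the cost of `(a, c]` by a change at `b`. -/
noncomputable def gain (y : ℕ → ℝ) (a b c : ℕ) : ℝ :=
  segCost y a c - segCost y a b - segCost y b c

lemma sum_Ioc_split (y : ℕ → ℝ) {a b c : ℕ} (h1 : a ≤ b) (h2 : b ≤ c) :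
    ∑ i ∈ Finset.Ioc a c, y i = ∑ i ∈ Finset.Ioc a b, y i + ∑ i ∈ Finset.Ioc b c, y i := by
  rw [← Finset.Ioc_union_Ioc_eq_Ioc h1 h2, Finset.sum_union]
  exact Finset.Ioc_disjoint_Ioc_of_le le_rfl

/-- This is the between-groups sum of squares. For noise the difference of the two means has
variance proportional to the denominator, so the gain is the square of a Gaussian whose variance
does not depend on the arm lengths. -/
lemma gain_eq (y : ℕ → ℝ) {a b c : ℕ} (h1 : a < b) (h2 : b < c) :
    gain y a b c = ((∑ i ∈ Finset.Ioc a b, y i) / (b - a : ℝ)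
      - (∑ i ∈ Finset.Ioc b c, y i) / (c - b : ℝ)) ^ 2
      / (1 / (b - a : ℝ) + 1 / (c - b : ℝ)) := by
  have e1 : (0 : ℝ) < (b : ℝ) - a := by
    have : (a : ℝ) < b := by exact_mod_cast h1
    linarith
  have e2 : (0 : ℝ) < (c : ℝ) - b := by
    have : (b : ℝ) < c := by exact_mod_cast h2
    linarith
  have e3 : (c : ℝ) - a = (b - a) + (c - b) := by ring
  unfold gain
  rw [segCost_eq y (h1.trans h2), segCost_eq y h1, segCost_eq y h2,
    sum_Ioc_split y h1.le h2.le, sum_Ioc_split (fun i => y i ^ 2) h1.le h2.le, e3]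
  set p := (b : ℝ) - a
  set q := (c : ℝ) - b
  have : 0 < p + q := by positivity
  field_simp
  ring

lemma gain_nonneg (y : ℕ → ℝ) {a b c : ℕ} (h1 : a ≤ b) (h2 : b ≤ c) : 0 ≤ gain y a b c := by
  rcases h1.eq_or_lt with rfl | h1
  · simp [gain]
  rcases h2.eq_or_lt with rfl | h2
  · simp [gain]
  rw [gain_eq y h1 h2]
  have e1 : (a : ℝ) < b := by exact_mod_cast h1
  have e2 : (b : ℝ) < c := by exact_mod_cast h2
  have : 0 < (b : ℝ) - a := by linarith
  have : 0 < (c : ℝ) - b := by linarith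
  positivity

lemma segCost_split_le (y : ℕ → ℝ) {a b c : ℕ} (h1 : a ≤ b) (h2 : b ≤ c) :
    segCost y a b + segCost y b c ≤ segCost y a c := by
  have := gain_nonneg y h1 h2
  unfold gain at this
  linarith

/-! ### PELT finds an optimal segmentation -/

/-- The invariant of the PELT recursion after the points `P` in `(a, N]`. -/
structure PeltInv (y : ℕ → ℝ) (β : ℝ) (a : ℕ) (P : List ℕ) (N : ℕ) (R : Cand × List Cand) :
    Prop where
  sound : ∀ c ∈ R.1 :: R.2, c.cps.reverse.Pairwise (· < ·) ∧ c.cps ⊆ P ∧ c.loc ≤ N ∧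
    ∀ s, c.F + segCost y c.loc s = penCost y β a c.cps.reverse s
  complete : ∀ T : List ℕ, T.Pairwise (· < ·) → T ⊆ P → ∀ s, N ≤ s →
    ∃ c ∈ R.1 :: R.2, c.F + segCost y c.loc s ≤ penCost y β a T s

lemma mem_eval_iff (y : ℕ → ℝ) (s : ℕ) (R : Cand × List Cand) (x : ℝ × Cand) :
    x ∈ (evalCand y s R.1).val :: (evalAll y s R.2).val ↔
      ∃ c ∈ R.1 :: R.2, (c.F + segCost y c.loc s, c) = x := by
  simp only [evalCand, evalAll_val, Timed.tick_val, List.mem_cons, List.mem_map]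
  constructor
  · rintro (rfl | ⟨c, hc, rfl⟩)
    · exact ⟨_, Or.inl rfl, rfl⟩
    · exact ⟨c, Or.inr hc, rfl⟩
  · rintro ⟨c, rfl | hc, rfl⟩
    · exact Or.inl rfl
    · exact Or.inr ⟨c, hc, rfl⟩

lemma PeltInv.argmin {y : ℕ → ℝ} {β : ℝ} {a : ℕ} {P : List ℕ} {N : ℕ} {R : Cand × List Cand}
    (h : PeltInv y β a P N R) {s : ℕ} (hs : N ≤ s) :
    let b := (argminScan (evalCand y s R.1).val (evalAll y s R.2).val).val
    b.2.cps.reverse.Pairwise (· < ·) ∧ b.2.cps ⊆ P ∧ b.1 = penCost y β a b.2.cps.reverse s ∧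
      ∀ T : List ℕ, T.Pairwise (· < ·) → T ⊆ P → b.1 ≤ penCost y β a T s := by
  intro b
  obtain ⟨c, hc, hcb⟩ := (mem_eval_iff y s R b).1 (argminScan_mem _ _)
  obtain ⟨h1, h2, -, h4⟩ := h.sound c hc
  rw [← hcb]
  refine ⟨h1, h2, h4 s, fun T hT hTP => ?_⟩
  obtain ⟨c', hc', hle⟩ := h.complete T hT hTP s hs
  have : b.1 ≤ c'.F + segCost y c'.loc s :=
    argminScan_le _ _ (c'.F + segCost y c'.loc s, c') ((mem_eval_iff y s R _).2 ⟨c', hc', rfl⟩)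
  rw [← hcb] at this
  exact this.trans hle

/-- A segmentation ending in `s` is covered by the new candidate, by optimality of `b` among the
segmentations before `s`. One that avoids `s` is covered by an old candidate, or by the new one if
that candidate has just been pruned. -/
lemma PeltInv.step {y : ℕ → ℝ} {β : ℝ} {a : ℕ} {P : List ℕ} {N : ℕ} {R : Cand × List Cand}
    (h : PeltInv y β a P N R) {s : ℕ} (hs : N ≤ s) (hP : ∀ p ∈ P, p < s) :
    PeltInv y β a (P ++ [s]) s (peltStep y β R s).val := by
  have hb := h.argmin hs
  set b := (argminScan (evalCand y s R.1).val (evalAll y s R.2).val).val with hbdef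
  obtain ⟨hb1, hb2, hb3, hb4⟩ := hb
  have hval : (peltStep y β R s).val = (⟨s, b.1 + β, s :: b.2.cps⟩,
      (((evalCand y s R.1).val :: (evalAll y s R.2).val).filter
        fun x => x.1 ≤ b.1 + β).map Prod.snd) := by
    simp [peltStep, prune_val, hbdef]
  rw [hval]
  have hnew : ∀ t, b.1 + β + segCost y s t = penCost y β a (s :: b.2.cps).reverse t := by
    intro t
    rw [List.reverse_cons, penCost_concat, ← hb3]
  constructor
  · intro c hc
    rcases List.mem_cons.1 hc with rfl | hc
    · refine ⟨?_, ?_, le_rfl, hnew⟩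
      · rw [List.reverse_cons, List.pairwise_append]
        refine ⟨hb1, by simp, fun x hx z hz => ?_⟩
        rw [List.mem_singleton.1 hz]
        exact hP x (hb2 (List.mem_reverse.1 hx))
      · intro x hx
        rcases List.mem_cons.1 hx with rfl | hx
        · simp
        · exact List.mem_append_left _ (hb2 hx)
    · obtain ⟨x, hx, rfl⟩ := List.mem_map.1 hc
      obtain ⟨c', hc', rfl⟩ := (mem_eval_iff y s R x).1 (List.mem_of_mem_filter hx)
      obtain ⟨h1, h2, h3, h4⟩ := h.sound c' hc'
      exact ⟨h1, fun z hz => List.mem_append_left _ (h2 hz), h3.trans hs, h4⟩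
  · intro T hT hTP t ht
    by_cases hsT : s ∈ T
    · refine ⟨_, List.mem_cons_self, ?_⟩
      obtain ⟨T₁, T₂, rfl⟩ := List.append_of_mem hsT
      have hT₂ : T₂ = [] := by
        rcases T₂ with _ | ⟨u, T₂⟩
        · rfl
        · exfalso
          rw [List.pairwise_append] at hT
          have h1 : s < u := (List.pairwise_cons.1 hT.2.1).1 u (by simp)
          have h2 := hTP (show u ∈ T₁ ++ s :: u :: T₂ by simp)
          rcases List.mem_append.1 h2 with h2 | h2
          · exact absurd (hP u h2) (by omega)
          · rw [List.mem_singleton.1 h2] at h1; omega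
      subst hT₂
      rw [List.pairwise_append] at hT
      rw [penCost_concat]
      have : b.1 ≤ penCost y β a T₁ s := by
        refine hb4 T₁ hT.1 fun x hx => ?_
        rcases List.mem_append.1 (hTP (List.mem_append_left _ hx)) with h2 | h2
        · exact h2
        · exact absurd (hT.2.2 x hx s (by simp)) (by rw [List.mem_singleton.1 h2]; omega)
      simpa using this
    · have hTP' : T ⊆ P := fun x hx => by
        rcases List.mem_append.1 (hTP hx) with h2 | h2
        · exact h2
        · exact absurd (List.mem_singleton.1 h2 ▸ hx) hsT
      obtain ⟨c, hc, hle⟩ := h.complete T hT hTP' t (hs.trans ht)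
      by_cases hk : c.F + segCost y c.loc s ≤ b.1 + β
      · refine ⟨c, List.mem_cons_of_mem _ ?_, hle⟩
        exact List.mem_map.2 ⟨(c.F + segCost y c.loc s, c),
          List.mem_filter.2 ⟨(mem_eval_iff y s R _).2 ⟨c, hc, rfl⟩, by simpa using hk⟩, rfl⟩
      -- The candidate was pruned: its cost up to `s` exceeds the new `F s`. Splitting its last
      -- segment at `s` only lowers the cost, so the new candidate beats it at every later `t`.
      · refine ⟨_, List.mem_cons_self, ?_⟩
        have := segCost_split_le y ((h.sound c hc).2.2.1.trans hs) ht
        push Not at hk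
        simp only
        linarith

lemma PeltInv.loop {y : ℕ → ℝ} {β : ℝ} {a : ℕ} (B : List ℕ) {P : List ℕ} {N : ℕ}
    {R : Cand × List Cand} (h : PeltInv y β a P N R) (hB : (P ++ B).Pairwise (· < ·))
    (hN : ∀ b ∈ B, N ≤ b) {e : ℕ} (hNe : N ≤ e) (he : ∀ b ∈ B, b ≤ e) :
    ∃ N' ≤ e, PeltInv y β a (P ++ B) N' (peltLoop y β R B).val := by
  induction B generalizing P N R with
  | nil => exact ⟨N, hNe, by simpa [peltLoop] using h⟩
  | cons s B ih =>
    have hB' : ((P ++ [s]) ++ B).Pairwise (· < ·) := by simpa using hB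
    have hp := List.pairwise_append.1 hB
    have hstep := h.step (hN s (by simp)) fun p hp' => hp.2.2 p hp' s (by simp)
    obtain ⟨N', hN', hinv⟩ := ih hstep hB'
      (fun b hb => ((List.pairwise_cons.1 hp.2.1).1 b hb).le) (he s (by simp))
      (fun b hb => he b (by simp [hb]))
    exact ⟨N', hN', by simpa [peltLoop] using hinv⟩

/-- The output of PELT is a segmentation of least penalised cost. -/
lemma pelt_optimal (y : ℕ → ℝ) (β : ℝ) {a e : ℕ} (hae : a ≤ e) {B : List ℕ}
    (hB : B.Pairwise (· < ·)) :
    (pelt y β a e B).val.Pairwise (· < ·) ∧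
    (∀ t ∈ (pelt y β a e B).val, t ∈ B ∧ a < t ∧ t < e) ∧
    ∀ T : List ℕ, T.Pairwise (· < ·) → (∀ t ∈ T, t ∈ B ∧ a < t ∧ t < e) →
      penCost y β a (pelt y β a e B).val e ≤ penCost y β a T e := by
  set B' := B.filter fun b => a < b ∧ b < e with hB'def
  have hmem : ∀ t, t ∈ B' ↔ t ∈ B ∧ a < t ∧ t < e := by simp [hB'def]
  have hinit : PeltInv y β a [] a (⟨a, 0, []⟩, []) := by
    constructor
    · simp [penCost, segmCost]
    · intro T _ hT s _
      rw [List.subset_nil.1 hT]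
      simp [penCost, segmCost]
  obtain ⟨N, hN, hinv⟩ := hinit.loop B' (by simpa using hB.filter _)
    (fun b hb => ((hmem b).1 hb).2.1.le) hae (fun b hb => ((hmem b).1 hb).2.2.le)
  obtain ⟨h1, h2, h3, h4⟩ := hinv.argmin hN
  set b := (argminScan (evalCand y e (peltLoop y β (⟨a, 0, []⟩, []) B').val.1).val
    (evalAll y e (peltLoop y β (⟨a, 0, []⟩, []) B').val.2).val).val with hb
  have hval : (pelt y β a e B).val = b.2.cps.reverse := by simp [pelt, hb, hB'def]
  rw [hval]
  refine ⟨h1, fun t ht => (hmem t).1 ?_, fun T hT hTB => ?_⟩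
  · simpa using h2 (List.mem_reverse.1 ht)
  · rw [← h3]
    exact h4 T hT fun t ht => by simpa using (hmem t).2 (hTB t ht)

/-! ### Surgery on segmentations -/

lemma segmCost_split (y : ℕ → ℝ) {p e : ℕ} (hpe : p ≤ e) (T : List ℕ) {a : ℕ} (hap : a ≤ p)
    (hT : T.Pairwise (· < ·)) (ha : ∀ t ∈ T, a < t) (he : ∀ t ∈ T, t < e) :
    segmCost y a (T.filter (· < p)) p + segmCost y p (T.filter (p < ·)) e ≤ segmCost y a T e := by
  induction T generalizing a with
  | nil => simpa [segmCost] using segCost_split_le y hap hpe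
  | cons t T ih =>
    have hT' := List.pairwise_cons.1 hT
    have hat : a < t := ha t (by simp)
    rcases lt_trichotomy t p with h | h | h
    · have := ih h.le hT'.2 hT'.1 fun u hu => he u (by simp [hu])
      simp only [List.filter_cons, h, decide_true, if_true, segmCost, not_lt.2 h.le, decide_false,
        Bool.false_eq_true, if_false]
      linarith
    · subst h
      have h1 : T.filter (· < t) = [] := by
        simpa [List.filter_eq_nil_iff] using fun u hu => (hT'.1 u hu).le
      have h2 : T.filter (t < ·) = T := by
        simpa [List.filter_eq_self] using hT'.1
      simp [h1, h2, segmCost]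
    · have h1 : T.filter (· < p) = [] := by
        simpa [List.filter_eq_nil_iff] using fun u hu => (h.trans (hT'.1 u hu)).le
      have h2 : T.filter (p < ·) = T := by
        simpa [List.filter_eq_self] using fun u hu => h.trans (hT'.1 u hu)
      have := segCost_split_le y hap h.le
      simp only [List.filter_cons, h1, h2, h, not_lt.2 h.le, decide_true, decide_false, if_true,
        Bool.false_eq_true, if_false, segmCost]
      linarith

/-- Deleting `t` affects only the two segments that meet there. The neighbours `p` and `q` are
described as the largest point before and the smallest point after, the ends `a` and `e` included.
-/
lemma segmCost_remove (y : ℕ → ℝ) (t e : ℕ) (T₁ T₂ : List ℕ) (a : ℕ)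
    (h1 : (a :: T₁).Pairwise (· ≤ ·)) (h2 : (T₂ ++ [e]).Pairwise (· ≤ ·)) :
    ∃ p ∈ a :: T₁, ∃ q ∈ T₂ ++ [e], (∀ x ∈ a :: T₁, x ≤ p) ∧ (∀ x ∈ T₂ ++ [e], q ≤ x) ∧
      segmCost y a (T₁ ++ T₂) e = segmCost y a (T₁ ++ t :: T₂) e + gain y p t q := by
  induction T₁ generalizing a with
  | nil =>
    rcases T₂ with _ | ⟨u, T₂⟩
    · exact ⟨a, by simp, e, by simp, by simp, by simp, by simp [segmCost, gain]⟩
    · refine ⟨a, by simp, u, by simp, by simp, ?_, by simp [segmCost, gain]; ring⟩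
      intro x hx
      rcases List.mem_cons.1 hx with rfl | hx
      · exact le_rfl
      · exact (List.pairwise_cons.1 h2).1 x hx
  | cons u T₁ ih =>
    obtain ⟨p, hp, q, hq, hp', hq', heq⟩ := ih u (List.pairwise_cons.1 h1).2
    refine ⟨p, List.mem_cons_of_mem _ hp, q, hq, ?_, hq', by simp [segmCost, heq]; ring⟩
    intro x hx
    rcases List.mem_cons.1 hx with rfl | hx
    · exact ((List.pairwise_cons.1 h1).1 u (by simp)).trans (hp' u (by simp))
    · exact hp' x hx

/-- Adding the points `s i` to the segmentation cannot raise the unpenalised cost, and the refined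
cost is a sum over the stretches between them. -/
lemma sum_segmCost_le (y : ℕ → ℝ) (s : ℕ → ℕ) (r : ℕ) (hs : StrictMonoOn s (Set.Iic (r + 1)))
    (T : List ℕ) (hT : T.Pairwise (· < ·)) (hmem : ∀ t ∈ T, s 0 < t ∧ t < s (r + 1)) :
    ∑ i ∈ Finset.range (r + 1),
        segmCost y (s i) (T.filter fun t => s i < t ∧ t < s (i + 1)) (s (i + 1))
      ≤ segmCost y (s 0) T (s (r + 1)) := by
  induction r generalizing T with
  | zero =>
    have : (T.filter fun t => s 0 < t ∧ t < s (0 + 1)) = T := by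
      rw [List.filter_eq_self]; intro t ht; simpa using hmem t ht
    rw [zero_add, Finset.sum_range_one, this]
  | succ r ih =>
    have h0 : s 0 ≤ s (r + 1) := hs.monotoneOn (by simp) (by simp) (by omega)
    have h1 : s (r + 1) < s (r + 1 + 1) := hs (by simp) (by simp) (by omega)
    have hsplit := segmCost_split y h1.le T h0 hT (fun t ht => (hmem t ht).1)
      (fun t ht => (hmem t ht).2)
    have hih := ih (hs.mono fun x hx => by simp only [Set.mem_Iic] at hx ⊢; omega)
      (T.filter (· < s (r + 1))) (hT.filter _)
      (fun t ht => by
        have := List.mem_filter.1 ht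
        exact ⟨(hmem t this.1).1, by simpa using this.2⟩)
    rw [Finset.sum_range_succ]
    have e1 : (T.filter fun t => s (r + 1) < t ∧ t < s (r + 1 + 1)) = T.filter (s (r + 1) < ·) := by
      apply List.filter_congr
      intro t ht
      simp [(hmem t ht).2]
    have e2 : ∀ i ∈ Finset.range (r + 1),
        segmCost y (s i) (T.filter fun t => s i < t ∧ t < s (i + 1)) (s (i + 1)) =
        segmCost y (s i) ((T.filter (· < s (r + 1))).filter
          fun t => s i < t ∧ t < s (i + 1)) (s (i + 1)) := by
      intro i hi
      rw [Finset.mem_range] at hi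
      have : s (i + 1) ≤ s (r + 1) := hs.monotoneOn (by simp; omega) (by simp) (by omega)
      rw [List.filter_filter]
      congr 1
      apply List.filter_congr
      intro t _
      simp only [← Bool.decide_and, decide_eq_decide]
      constructor
      · rintro ⟨h, h'⟩; exact ⟨⟨h, h'⟩, by omega⟩
      · rintro ⟨h, -⟩; exact h
    rw [e1, Finset.sum_congr rfl e2]
    linarith

lemma segmCost_map_range' (y : ℕ → ℝ) (s : ℕ → ℕ) (r : ℕ) :
    segmCost y (s 0) ((List.range' 1 r).map s) (s (r + 1)) =
      ∑ i ∈ Finset.range (r + 1), segCost y (s i) (s (i + 1)) := by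
  induction r with
  | zero => simp [segmCost]
  | succ r ih =>
    rw [List.range'_concat, List.map_append, List.map_singleton, segmCost_append_cons,
      Finset.sum_range_succ, ← ih]
    simp [segmCost, add_comm]

/-! ### Optimal segmentations of a signal with noise -/

/-- `T` is a segmentation of `y_{a+1}, …, y_e` of least penalised cost among those with
changepoints in `B`. -/
structure IsOptimal (y : ℕ → ℝ) (β : ℝ) (a e : ℕ) (B : Set ℕ) (T : List ℕ) : Prop where
  sorted : T.Pairwise (· < ·)
  mem : ∀ t ∈ T, t ∈ B
  le : ∀ T' : List ℕ, T'.Pairwise (· < ·) → (∀ t ∈ T', t ∈ B) →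
    penCost y β a T e ≤ penCost y β a T' e

/-- There is no change strictly between `p` and `q`. -/
def NoChange {m : ℕ} (τ : Fin m → ℕ) (p q : ℕ) : Prop := ∀ j, τ j ≤ p ∨ q ≤ τ j

lemma NoChange.mono {m : ℕ} {τ : Fin m → ℕ} {p q p' q' : ℕ} (h : NoChange τ p q) (hp : p ≤ p')
    (hq : q' ≤ q) : NoChange τ p' q' := fun j =>
  (h j).imp (fun h => h.trans hp) fun h => hq.trans h

/-- Deleting `t` saves `β` and costs the gain between its neighbours, so this gain is at least `β`,
which noise alone cannot produce. The set `B` need not be an interval: a sublist of an admissible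
list is admissible. -/
lemma IsOptimal.exists_change {y : ℕ → ℝ} {β : ℝ} {a e m : ℕ} {B : Set ℕ} {T : List ℕ}
    {τ : Fin m → ℕ} (hT : IsOptimal y β a e B T) (hB : ∀ t ∈ B, a < t ∧ t < e)
    (hG : ∀ p t q, a ≤ p → p < t → t < q → q ≤ e → NoChange τ p q → gain y p t q < β)
    {t : ℕ} (ht : t ∈ T) :
    ∃ j, (∀ x, x = a ∨ x ∈ T → x < t → x < τ j) ∧ (∀ x, x = e ∨ x ∈ T → t < x → τ j < x) := by
  obtain ⟨T₁, T₂, rfl⟩ := List.append_of_mem ht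
  have hs := List.pairwise_append.1 hT.sorted
  have hs2 := List.pairwise_cons.1 hs.2.1
  have hmem : ∀ x ∈ T₁ ++ t :: T₂, a < x ∧ x < e := fun x hx => hB x (hT.mem x hx)
  obtain ⟨p, hp, q, hq, hp', hq', heq⟩ := segmCost_remove y t e T₁ T₂ a
    (List.pairwise_cons.2 ⟨fun x hx => (hmem x (by simp [hx])).1.le, hs.1.imp le_of_lt⟩)
    (List.pairwise_append.2 ⟨hs2.2.imp le_of_lt, by simp, fun x hx z hz => by
      rw [List.mem_singleton.1 hz]; exact (hmem x (by simp [hx])).2.le⟩)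
  have hle := hT.le (T₁ ++ T₂)
    (List.pairwise_append.2 ⟨hs.1, hs2.2, fun x hx z hz => hs.2.2 x hx z (by simp [hz])⟩)
    (fun x hx => hT.mem x (by
      rcases List.mem_append.1 hx with h | h <;> simp [h]))
  have hgain : β ≤ gain y p t q := by
    simp only [penCost, List.length_append, List.length_cons, heq] at hle
    push_cast at hle
    linarith
  have hpt : p < t := by
    rcases List.mem_cons.1 hp with rfl | hp
    · exact (hmem t (by simp)).1
    · exact hs.2.2 p hp t (by simp)
  have hap : a ≤ p := hp' a (by simp)
  have hqe : q ≤ e := hq' e (by simp)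
  have htq : t < q := by
    rcases List.mem_append.1 hq with hq | hq
    · exact hs2.1 q hq
    · rw [List.mem_singleton.1 hq]; exact (hmem t (by simp)).2
  have hnot : ¬ NoChange τ p q := fun h => absurd (hG p t q hap hpt htq hqe h) (not_lt.2 hgain)
  simp only [NoChange, not_forall, not_or, not_le] at hnot
  obtain ⟨j, hj1, hj2⟩ := hnot
  refine ⟨j, fun x hx hxt => lt_of_le_of_lt (hp' x ?_) hj1,
    fun x hx hxt => lt_of_lt_of_le hj2 (hq' x ?_)⟩
  · rcases hx with rfl | hx
    · simp
    · rcases List.mem_append.1 hx with h | h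
      · simp [h]
      · rcases List.mem_cons.1 h with rfl | h
        · omega
        · exact absurd (hs2.1 x h) (by omega)
  · rcases hx with rfl | hx
    · simp
    · rcases List.mem_append.1 hx with h | h
      · exact absurd (hs.2.2 x h t (by simp)) (by omega)
      · rcases List.mem_cons.1 h with rfl | h
        · omega
        · simp [h]

/-- If every change within a homogeneous stretch gains less than the penalty, then an optimal
segmentation has at most twice as many changepoints as there are changes. -/
lemma IsOptimal.length_le_two_mul {y : ℕ → ℝ} {β : ℝ} {a e m : ℕ} {B : Set ℕ} {T : List ℕ}
    {τ : Fin m → ℕ} (hT : IsOptimal y β a e B T) (hB : ∀ t ∈ B, a < t ∧ t < e)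
    (hG : ∀ p t q, a ≤ p → p < t → t < q → q ≤ e → NoChange τ p q → gain y p t q < β) :
    T.length ≤ 2 * m := by
  have hex : ∀ t ∈ T, ∃ j, (∀ x, x = a ∨ x ∈ T → x < t → x < τ j) ∧
      (∀ x, x = e ∨ x ∈ T → t < x → τ j < x) := fun t ht => hT.exists_change hB hG ht
  rcases T.eq_nil_or_concat with rfl | ⟨T', t₀, hT'⟩
  · simp
  have : Nonempty (Fin m) := ⟨(hex t₀ (by simp [hT'])).choose⟩
  choose! J hJ1 hJ2 using hex
  have hcard : T.toFinset.card = T.length :=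
    List.toFinset_card_of_nodup (hT.sorted.imp fun h => h.ne)
  rw [← hcard]
  have : T.toFinset.card ≤ (Finset.univ : Finset (Fin m × Bool)).card := by
    -- If `t < t'` share a change then it lies strictly after `t` and strictly before `t'`. So the
    -- change together with the side on which it lies determines the changepoint.
    refine Finset.card_le_card_of_injOn (fun t => (J t, decide (τ (J t) ≤ t)))
      (fun t _ => Finset.mem_univ _) ?_
    have key : ∀ t ∈ T, ∀ t' ∈ T, t < t' → J t = J t' →
        (τ (J t) ≤ t ↔ τ (J t') ≤ t') → False := by
      intro t ht t' ht' hlt hJ hiff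
      have h1 := hJ1 t' ht' t (Or.inr ht) hlt
      have h2 := hJ2 t ht t' (Or.inr ht') hlt
      rw [hJ] at hiff h2
      omega
    intro t ht t' ht' heq
    simp only [Finset.mem_coe, List.mem_toFinset] at ht ht'
    simp only [Prod.mk.injEq, decide_eq_decide] at heq
    rcases lt_trichotomy t t' with h | h | h
    · exact (key t ht t' ht' h heq.1 heq.2).elim
    · exact h
    · exact (key t' ht' t ht h heq.1.symm heq.2.symm).elim
  refine this.trans ?_
  simp [mul_comm]

/-- An optimal segmentation has a changepoint near every change that is worth three penalties. -/
lemma IsOptimal.exists_near {y : ℕ → ℝ} {β : ℝ} (hβ : 0 ≤ β) {a e : ℕ} {T : List ℕ}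
    (hT : IsOptimal y β a e (Set.Ioo a e) T) {u s w : ℕ} (hau : a < u) (hus : u < s) (hsw : s < w)
    (hwe : w < e) (hgain : 3 * β < gain y u s w) : ∃ t ∈ T, u < t ∧ t < w := by
  by_contra! hno
  have h1 := segmCost_split y (by omega : u ≤ e) T hau.le hT.sorted
    (fun t ht => (hT.mem t ht).1) (fun t ht => (hT.mem t ht).2)
  have h2 := segmCost_split y hwe.le (T.filter (u < ·)) (by omega : u ≤ w) (hT.sorted.filter _)
    (fun t ht => by simpa using (List.mem_filter.1 ht).2)
    (fun t ht => (hT.mem t (List.mem_filter.1 ht).1).2)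
  have hnil : (T.filter (u < ·)).filter (· < w) = [] := by
    rw [List.filter_eq_nil_iff]
    intro t ht
    have := List.mem_filter.1 ht
    simpa using hno t this.1 (by simpa using this.2)
  rw [hnil] at h2
  set A := T.filter (· < u) with hA
  set C := (T.filter (u < ·)).filter (w < ·) with hC
  have hmemA : ∀ t ∈ A, t ∈ T ∧ t < u := fun t ht => by simpa [hA] using ht
  have hmemC : ∀ t ∈ C, t ∈ T ∧ w < t := fun t ht => by
    have : t ∈ T ∧ w < t ∧ u < t := by simpa [hC] using ht
    exact ⟨this.1, this.2.1⟩
  have hlen : A.length + C.length ≤ T.length := by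
    have e1 : A.length + (T.filter (u < ·)).length ≤ T.length := by
      rw [hA, ← List.countP_eq_length_filter, ← List.countP_eq_length_filter,
        List.length_eq_countP_add_countP (fun t => decide (t < u)) (l := T)]
      gcongr
      apply List.countP_mono_left
      intro t _ h
      simp at h ⊢
      omega
    have e2 : C.length ≤ (T.filter (u < ·)).length := List.length_filter_le _ _
    omega
  -- Competitor: `T` with `u`, `s`, `w` inserted. It has at most three more points, and lowers the
  -- cost by at least the gain at `s`, which exceeds three penalties.
  have hle := hT.le (A ++ u :: ([] ++ s :: ([] ++ w :: C))) ?_ ?_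
  · simp only [penCost, segmCost_append_cons] at hle
    simp only [segmCost] at hle h2
    have e3 : ((A.length + C.length : ℕ) : ℝ) ≤ T.length := by exact_mod_cast hlen
    simp only [gain, List.length_append, List.length_cons, List.nil_append] at hle hgain
    push_cast at hle e3
    nlinarith
  · simp only [List.nil_append]
    refine List.pairwise_append.2 ⟨hT.sorted.filter _, ?_, ?_⟩
    · simp only [List.pairwise_cons, List.mem_cons, forall_eq_or_imp]
      refine ⟨⟨hus, by omega, fun t ht => ?_⟩, ⟨hsw, fun t ht => ?_⟩, fun t ht => ?_,
        (hT.sorted.filter _).filter _⟩ <;> have := (hmemC t ht).2 <;> omega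
    · intro t ht z hz
      have h3 := (hmemA t ht).2
      simp only [List.mem_cons] at hz
      rcases hz with rfl | rfl | rfl | hz
      · omega
      · omega
      · omega
      · have := (hmemC z hz).2; omega
  · intro t ht
    simp only [List.nil_append, List.mem_append, List.mem_cons] at ht
    rcases ht with h | rfl | rfl | rfl | h
    · exact hT.mem t (hmemA t h).1
    · exact ⟨by omega, by omega⟩
    · exact ⟨by omega, by omega⟩
    · exact ⟨by omega, by omega⟩
    · exact hT.mem t (hmemC t h).1

/-- Consecutive elements of a finite set in `(a, e)`, with `a` and `e` at the ends. -/
lemma exists_enumeration {a e : ℕ} (hae : a < e) (S : Finset ℕ) (hS : ∀ x ∈ S, a < x ∧ x < e) :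
    ∃ s : ℕ → ℕ, s 0 = a ∧ s (S.card + 1) = e ∧ StrictMonoOn s (Set.Iic (S.card + 1)) ∧
      (∀ i, 1 ≤ i → i ≤ S.card → s i ∈ S) ∧ ∀ x ∈ S, ∃ i, 1 ≤ i ∧ i ≤ S.card ∧ s i = x := by
  set U := insert a (insert e S) with hU
  have hcard : U.card = S.card + 2 := by
    rw [Finset.card_insert_of_notMem, Finset.card_insert_of_notMem]
    · intro h; exact absurd (hS e h).2 (by omega)
    · simp only [Finset.mem_insert, not_or]
      exact ⟨hae.ne, fun h => absurd (hS a h).1 (by omega)⟩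
  set f := U.orderEmbOfFin hcard
  have hf0 : f ⟨0, by omega⟩ = a := by
    rw [Finset.orderEmbOfFin_zero hcard (by omega)]
    apply le_antisymm
    · exact Finset.min'_le _ _ (by simp [hU])
    · refine Finset.le_min' _ _ _ fun x hx => ?_
      simp only [hU, Finset.mem_insert] at hx
      rcases hx with rfl | rfl | h
      · exact le_rfl
      · exact hae.le
      · exact (hS x h).1.le
  have hfl : f ⟨S.card + 1, by omega⟩ = e := by
    have := Finset.orderEmbOfFin_last hcard (by omega)
    have h2 : f ⟨S.card + 1, by omega⟩ = U.max' (Finset.card_pos.1 (by omega)) := this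
    rw [h2]
    apply le_antisymm
    · refine Finset.max'_le _ _ _ fun x hx => ?_
      simp only [hU, Finset.mem_insert] at hx
      rcases hx with rfl | rfl | h
      · exact hae.le
      · exact le_rfl
      · exact (hS x h).2.le
    · exact Finset.le_max' _ _ (by simp [hU])
  have hmono : ∀ i j (hi : i < S.card + 2) (hj : j < S.card + 2), i < j → f ⟨i, hi⟩ < f ⟨j, hj⟩ :=
    fun i j hi hj hij => f.strictMono (by simpa using hij)
  refine ⟨fun i => if h : i < S.card + 2 then f ⟨i, h⟩ else 0, ?_, ?_, ?_, ?_, ?_⟩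
  · simpa using hf0
  · simpa using hfl
  · intro i hi j hj hij
    simp only [Set.mem_Iic] at hi hj
    have h1 : i < S.card + 2 := by omega
    have h2 : j < S.card + 2 := by omega
    simp only [h1, h2, dif_pos]
    exact hmono i j h1 h2 hij
  · intro i hi hi'
    have h1 : i < S.card + 2 := by omega
    simp only [h1, dif_pos]
    have hm : f ⟨i, h1⟩ ∈ U := Finset.orderEmbOfFin_mem _ _ _
    have l1 := hmono 0 i (by omega) h1 (by omega)
    have l2 := hmono i (S.card + 1) h1 (by omega) (by omega)
    rw [hf0] at l1
    rw [hfl] at l2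
    simp only [hU, Finset.mem_insert] at hm
    rcases hm with h | h | h
    · omega
    · omega
    · exact h
  · intro x hx
    have hm : x ∈ Set.range f := by
      rw [Finset.range_orderEmbOfFin]; simp [hU, hx]
    obtain ⟨⟨i, hi⟩, rfl⟩ := hm
    refine ⟨i, ?_, ?_, by simp [hi]⟩
    · rcases Nat.eq_zero_or_pos i with rfl | h
      · exact absurd (hS _ hx).1 (by rw [hf0]; omega)
      · exact h
    · by_contra h
      have : i = S.card + 1 := by omega
      subst this
      exact absurd (hS _ hx).2 (by rw [hfl]; omega)

/-! ### Segment costs of noise against sums of squares -/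

lemma segCost_congr_add_const {y W : ℕ → ℝ} {s t : ℕ} {c : ℝ}
    (h : ∀ i ∈ Finset.Ioc s t, y i = c + W i) : segCost y s t = segCost W s t := by
  rcases le_or_gt t s with hst | hst
  · simp [segCost, Finset.Ioc_eq_empty_of_le hst]
  have hpos : (0 : ℝ) < (t : ℝ) - s := by
    have : (s : ℝ) < t := by exact_mod_cast hst
    linarith
  have hcard : ((Finset.Ioc s t).card : ℝ) = (t : ℝ) - s := by
    rw [Nat.card_Ioc, Nat.cast_sub hst.le]
  unfold segCost
  rw [Finset.sum_congr rfl h, Finset.sum_add_distrib, Finset.sum_const, nsmul_eq_mul, hcard]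
  refine Finset.sum_congr rfl fun i hi => ?_
  rw [h i hi]
  field_simp
  ring

lemma segCost_le_sum_sq (W : ℕ → ℝ) {s t : ℕ} (h : s < t) :
    segCost W s t ≤ ∑ i ∈ Finset.Ioc s t, W i ^ 2 := by
  rw [segCost_eq W h]
  have : (0 : ℝ) < (t : ℝ) - s := by
    have : (s : ℝ) < t := by exact_mod_cast h
    linarith
  have : 0 ≤ (∑ i ∈ Finset.Ioc s t, W i) ^ 2 / (t - s : ℝ) := by positivity
  linarith

lemma sum_sq_le_segCost_add (W : ℕ → ℝ) {s t : ℕ} (hst : s < t) {h : ℝ}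
    (hW : (∑ i ∈ Finset.Ioc s t, W i) ^ 2 ≤ h * (t - s : ℝ)) :
    ∑ i ∈ Finset.Ioc s t, W i ^ 2 ≤ segCost W s t + h := by
  rw [segCost_eq W hst]
  have : (0 : ℝ) < (t : ℝ) - s := by
    have : (s : ℝ) < t := by exact_mod_cast hst
    linarith
  have : (∑ i ∈ Finset.Ioc s t, W i) ^ 2 / (t - s : ℝ) ≤ h := by rwa [div_le_iff₀ this]
  linarith

/-- The sums of `W` over the intervals between `p` and a point of `[a, e]` are at most of the order
of the square root of their length. -/
def Tame (W : ℕ → ℝ) (h : ℝ) (a e p : ℕ) : Prop :=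
  (∀ t, p < t → t ≤ e → (∑ i ∈ Finset.Ioc p t, W i) ^ 2 ≤ h * (t - p : ℝ)) ∧
  (∀ t, a ≤ t → t < p → (∑ i ∈ Finset.Ioc t p, W i) ^ 2 ≤ h * (p - t : ℝ))

lemma Tame.mono {W : ℕ → ℝ} {h : ℝ} {a e p a' e' : ℕ} (H : Tame W h a e p) (ha : a ≤ a')
    (he : e' ≤ e) : Tame W h a' e' p :=
  ⟨fun t h1 h2 => H.1 t h1 (h2.trans he), fun t h1 h2 => H.2 t (ha.trans h1) h2⟩

/-- Sums of squares about zero are additive, and on a piece with a tame endpoint they exceed the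
cost by at most `h`. There are at most three pieces; the outer ones have the tame endpoints `s` and
`e`, and the middle one is the reason for the condition on two changepoints. -/
lemma segCost_le_segmCost_of_tame {W : ℕ → ℝ} {h : ℝ} (hh : 0 ≤ h) {s e : ℕ} (hse : s < e)
    (hs : Tame W h s e s) (he : Tame W h s e e) {T : List ℕ} (hT : T.Pairwise (· < ·))
    (hmem : ∀ t ∈ T, s < t ∧ t < e) (hlen : T.length ≤ 2)
    (hT2 : T.length = 2 → ∃ t ∈ T, Tame W h s e t) :
    segCost W s e ≤ segmCost W s T e + 3 * h := by
  match T, hlen with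
  | [], _ => simp only [segmCost]; linarith
  | [t], _ =>
    have ht := hmem t (by simp)
    have h1 := sum_sq_le_segCost_add W ht.1 (hs.1 t ht.1 ht.2.le)
    have h2 := sum_sq_le_segCost_add W ht.2 (he.2 t ht.1.le ht.2)
    have h3 := segCost_le_sum_sq W hse
    rw [sum_Ioc_split _ ht.1.le ht.2.le] at h3
    simp only [segmCost]
    linarith
  | [t, u], _ =>
    have ht := hmem t (by simp)
    have hu := hmem u (by simp)
    have htu : t < u := by simpa using hT
    have h1 := sum_sq_le_segCost_add W ht.1 (hs.1 t ht.1 ht.2.le)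
    have h2 := sum_sq_le_segCost_add W hu.2 (he.2 u hu.1.le hu.2)
    have h3 := segCost_le_sum_sq W hse
    rw [sum_Ioc_split _ ht.1.le ht.2.le, sum_Ioc_split _ htu.le hu.2.le] at h3
    have h4 : (∑ i ∈ Finset.Ioc t u, W i) ^ 2 ≤ h * (u - t : ℝ) := by
      obtain ⟨x, hx, hxt⟩ := hT2 rfl
      simp only [List.mem_cons, List.not_mem_nil, or_false] at hx
      rcases hx with rfl | rfl
      · exact hxt.1 u htu hu.2.le
      · exact hxt.2 t ht.1.le htu
    have h5 := sum_sq_le_segCost_add W htu h4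
    simp only [segmCost]
    linarith

/-- With no tame point in the middle, removing the first changepoint is paid for by a gain; the
remaining one is covered by the tame ends. -/
lemma segCost_le_segmCost_of_gain_le {W : ℕ → ℝ} {h G : ℝ} (hh : 0 ≤ h) {s e : ℕ}
    (hs : Tame W h s e s) (he : Tame W h s e e) {T : List ℕ} (hT : T.Pairwise (· < ·))
    (hmem : ∀ t ∈ T, s < t ∧ t < e) (hlen : T.length = 2)
    (hG : ∀ p t q, s ≤ p → p < t → t < q → q ≤ e → gain W p t q ≤ G) :
    segCost W s e ≤ segmCost W s T e + 3 * h + G := by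
  match T, hlen with
  | [t, u], _ =>
    have ht := hmem t (by simp)
    have hu := hmem u (by simp)
    have htu : t < u := by simpa using hT
    have h1 := segCost_le_segmCost_of_tame hh (hu.1.trans hu.2) hs he (T := [u]) (by simp)
      (by simpa using hu) (by simp) (by simp)
    have h2 := hG s t u le_rfl ht.1 htu hu.2.le
    simp only [segmCost, gain] at *
    linarith

/-! ### Optimal segmentations of a chunk -/

section Chunk

variable {y W : ℕ → ℝ} {β G h : ℝ} {a e m Δ : ℕ} {T : List ℕ} {τ : Fin m → ℕ}

lemma NoChange.segCost_eq (hy : ∀ p q, NoChange τ p q → ∃ c, ∀ i ∈ Finset.Ioc p q, y i = c + W i)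
    {p q p' q' : ℕ} (hn : NoChange τ p q) (hp : p ≤ p') (hq : q' ≤ q) :
    segCost y p' q' = segCost W p' q' := by
  obtain ⟨c, hc⟩ := hy p' q' (hn.mono hp hq)
  exact segCost_congr_add_const hc

lemma NoChange.segmCost_eq
    (hy : ∀ p q, NoChange τ p q → ∃ c, ∀ i ∈ Finset.Ioc p q, y i = c + W i)
    {p q : ℕ} (hn : NoChange τ p q) {p' : ℕ} (hp : p ≤ p') (T : List ℕ)
    (hT : ∀ t ∈ T, p ≤ t ∧ t ≤ q) : segmCost y p' T q = segmCost W p' T q := by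
  induction T generalizing p' with
  | nil => exact hn.segCost_eq hy hp le_rfl
  | cons t T ih =>
    have ht := hT t (by simp)
    simp only [segmCost]
    rw [hn.segCost_eq hy hp ht.2, ih ht.1 fun u hu => hT u (by simp [hu])]

lemma NoChange.gain_eq (hy : ∀ p q, NoChange τ p q → ∃ c, ∀ i ∈ Finset.Ioc p q, y i = c + W i)
    {p t q : ℕ} (hn : NoChange τ p q) (h1 : p ≤ t) (h2 : t ≤ q) : gain y p t q = gain W p t q := by
  unfold gain
  rw [hn.segCost_eq hy le_rfl le_rfl, hn.segCost_eq hy le_rfl h2, hn.segCost_eq hy h1 le_rfl]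

/-- An optimal segmentation of a chunk has at most as many changepoints as there are changes in the
chunk. -/
lemma IsOptimal.length_le_card (hT : IsOptimal y β a e (Set.Ioo a e) T)
    (hy : ∀ p q, NoChange τ p q → ∃ c, ∀ i ∈ Finset.Ioc p q, y i = c + W i)
    (hh : 0 ≤ h) (hG0 : 0 ≤ G) (hβ : (m + 1) * (3 * h) + G < β)
    (hG : ∀ p t q, a ≤ p → p < t → t < q → q ≤ e → gain W p t q ≤ G)
    (hΔ : 0 < Δ)
    (hsep : ∀ j j', τ j < τ j' → τ j + 2 * Δ ≤ τ j')
    (htame : ∀ j, a < τ j → τ j < e → Tame W h a e a ∧ Tame W h a e e)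
    (htame' : ∀ j p, a ≤ p → p ≤ e → τ j ≤ p + Δ → p ≤ τ j + Δ → Tame W h a e p)
    (hloc : ∀ j, Δ < τ j → τ j + Δ < e → 3 * β < gain y (τ j - Δ) (τ j) (τ j + Δ)) :
    T.length ≤ (Finset.univ.filter fun j => a < τ j ∧ τ j < e).card := by
  have hβ0 : 0 ≤ β := by
    have : 0 ≤ (m + 1 : ℝ) * (3 * h) := by positivity
    linarith
  have hGβ : G < β := by
    have : 0 ≤ (m + 1 : ℝ) * (3 * h) := by positivity
    linarith
  set S := (Finset.univ.filter fun j => a < τ j ∧ τ j < e).image τ with hS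
  have hSmem : ∀ x, x ∈ S ↔ ∃ j, (a < τ j ∧ τ j < e) ∧ τ j = x := by simp [hS]
  have hSm : S.card ≤ m := by
    refine Finset.card_image_le.trans ((Finset.card_filter_le _ _).trans ?_)
    simp
  refine le_trans ?_ (Finset.card_image_le (s := Finset.univ.filter fun j => a < τ j ∧ τ j < e)
    (f := τ))
  rw [← hS]
  -- Assume at least one excess changepoint. The contradiction comes from comparing `T` with the
  -- segmentation at the true changes `s 1, …, s r`, where `s 0 = a` and `s (r + 1) = e`.
  by_contra! hlt
  have hex : ∀ t ∈ T, ∃ j, (∀ x, x = a ∨ x ∈ T → x < t → x < τ j) ∧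
      (∀ x, x = e ∨ x ∈ T → t < x → τ j < x) := fun t ht =>
    hT.exists_change (fun t ht => ht) (fun p t q h1 h2 h3 h4 hn => by
      rw [hn.gain_eq hy h2.le h3.le]
      exact (hG p t q h1 h2 h3 h4).trans_lt hGβ) ht
  obtain ⟨t₀, ht₀⟩ : ∃ t, t ∈ T := List.exists_mem_of_length_pos (by omega)
  have ht₀' := hT.mem t₀ ht₀
  obtain ⟨j₀, hj₀, hj₀'⟩ := hex t₀ ht₀
  have hj₁ : a < τ j₀ := hj₀ a (Or.inl rfl) ht₀'.1
  have hj₂ : τ j₀ < e := hj₀' e (Or.inl rfl) ht₀'.2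
  obtain ⟨hta, hte⟩ := htame j₀ hj₁ hj₂
  obtain ⟨s, hs0, hs1, hmono, hsS, hSs⟩ := exists_enumeration (hj₁.trans hj₂) S (fun x hx => by
    obtain ⟨j, hj, rfl⟩ := (hSmem x).1 hx
    exact hj)
  set r := S.card with hr
  have hr1 : 1 ≤ r := Finset.card_pos.2 ⟨_, (hSmem _).2 ⟨j₀, ⟨hj₁, hj₂⟩, rfl⟩⟩
  have hlt' : ∀ i i', i < i' → i' ≤ r + 1 → s i < s i' := fun i i' h1 h2 =>
    hmono (by simp; omega) (by simp; omega) h1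
  have hle' : ∀ i i', i ≤ i' → i' ≤ r + 1 → s i ≤ s i' := fun i i' h1 h2 =>
    hmono.monotoneOn (by simp; omega) (by simp; omega) h1
  have hsτ : ∀ i, 1 ≤ i → i ≤ r → ∃ j, (a < τ j ∧ τ j < e) ∧ τ j = s i := fun i h1 h2 =>
    (hSmem _).1 (hsS i h1 h2)
  have hgap : ∀ i i', 1 ≤ i → i < i' → i' ≤ r → s i + 2 * Δ ≤ s i' := by
    intro i i' h1 h2 h3
    obtain ⟨j, -, hj⟩ := hsτ i h1 (by omega)
    obtain ⟨j', -, hj'⟩ := hsτ i' (by omega) h3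
    rw [← hj, ← hj']
    apply hsep
    rw [hj, hj']
    exact hlt' _ _ h2 (by omega)
  have hpure : ∀ i, i ≤ r → NoChange τ (s i) (s (i + 1)) := by
    intro i hi j
    by_contra! hcon
    have h1 := hle' 0 i (by omega) (by omega)
    have h2 := hle' (i + 1) (r + 1) (by omega) le_rfl
    obtain ⟨i', h3, h4, h5⟩ := hSs (τ j) ((hSmem _).2 ⟨j, ⟨by omega, by omega⟩, rfl⟩)
    rcases le_or_gt i' i with h6 | h6
    · have := hle' i' i h6 (by omega); omega
    · have := hle' (i + 1) i' h6 (by omega); omega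
  set P : ℕ → List ℕ := fun i => T.filter fun t => s i < t ∧ t < s (i + 1) with hP
  have hPmem : ∀ i t, t ∈ P i ↔ t ∈ T ∧ s i < t ∧ t < s (i + 1) := fun i t => by simp [hP]
  have hPsort : ∀ i, (P i).Pairwise (· < ·) := fun i => hT.sorted.filter _
  -- The middle one of three changepoints in a homogeneous stretch would have no change between its
  -- neighbours. In the first and the last stretch, `a` and `e` act as neighbours, so two
  -- changepoints are already too many there.
  have hPlen : ∀ i, i ≤ r → (P i).length ≤ 2 := by
    intro i hi
    have hs := hPsort i
    have hm := hPmem i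
    rcases hPi : P i with _ | ⟨t₁, _ | ⟨t₂, _ | ⟨t₃, l⟩⟩⟩
    · simp
    · simp
    · simp
    · exfalso
      rw [hPi] at hs hm
      simp only [List.pairwise_cons, List.mem_cons, forall_eq_or_imp] at hs
      have m1 := (hm t₁).1 (by simp)
      have m2 := (hm t₂).1 (by simp)
      have m3 := (hm t₃).1 (by simp)
      obtain ⟨j, hj, hj'⟩ := hex t₂ m2.1
      have h1 := hj t₁ (Or.inr m1.1) (by omega)
      have h2 := hj' t₃ (Or.inr m3.1) (by omega)
      rcases hpure i hi j with h | h <;> omega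
  have hPlen0 : (P 0).length ≤ 1 := by
    have hs := hPsort 0
    have hm := hPmem 0
    rcases hPi : P 0 with _ | ⟨t₁, _ | ⟨t₂, l⟩⟩
    · simp
    · simp
    · exfalso
      rw [hPi] at hs hm
      simp only [List.pairwise_cons, List.mem_cons, forall_eq_or_imp] at hs
      have m1 := (hm t₁).1 (by simp)
      have m2 := (hm t₂).1 (by simp)
      obtain ⟨j, hj, hj'⟩ := hex t₁ m1.1
      have h1 := hj a (Or.inl rfl) (by omega)
      have h2 := hj' t₂ (Or.inr m2.1) (by omega)
      rcases hpure 0 (by omega) j with h | h <;> omega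
  have hPlenr : (P r).length ≤ 1 := by
    have hs := hPsort r
    have hm := hPmem r
    rcases hPi : P r with _ | ⟨t₁, _ | ⟨t₂, l⟩⟩
    · simp
    · simp
    · exfalso
      rw [hPi] at hs hm
      simp only [List.pairwise_cons, List.mem_cons, forall_eq_or_imp] at hs
      have m1 := (hm t₁).1 (by simp)
      have m2 := (hm t₂).1 (by simp)
      obtain ⟨j, hj, hj'⟩ := hex t₂ m2.1
      have h1 := hj t₁ (Or.inr m1.1) (by omega)
      have h2 := hj' e (Or.inl rfl) (by omega)
      rcases hpure r le_rfl j with h | h <;> omega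
  -- In a bad stretch no tame point is available: both changepoints are at distance at least `Δ`
  -- from its ends. Only such stretches cost an additional `G`.
  set bad : ℕ → Prop := fun i => (P i).length = 2 ∧ ∀ t ∈ P i, s i + Δ ≤ t ∧ t + Δ ≤ s (i + 1)
    with hbad
  classical
  have hends : ∀ i, i ≤ r + 1 → Tame W h a e (s i) := by
    intro i hi
    rcases Nat.eq_zero_or_pos i with rfl | h1
    · rwa [hs0]
    rcases eq_or_ne i (r + 1) with rfl | h2
    · rwa [hs1]
    obtain ⟨j, -, hj⟩ := hsτ i h1 (by omega)
    have h3 := hle' 0 i (by omega) (by omega)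
    have h4 := hle' i (r + 1) (by omega) (by omega)
    exact htame' j _ (by omega) (by omega) (by omega) (by omega)
  have hloss : ∀ i ∈ Finset.range (r + 1), segCost y (s i) (s (i + 1)) ≤
      segmCost y (s i) (P i) (s (i + 1)) + 3 * h + if bad i then G else 0 := by
    intro i hi
    have hi : i ≤ r := by rw [Finset.mem_range] at hi; omega
    have hai : a ≤ s i := by have := hle' 0 i (by omega) (by omega); omega
    have hei : s (i + 1) ≤ e := by have := hle' (i + 1) (r + 1) (by omega) (by omega); omega
    have t1 := (hends i (by omega)).mono hai hei
    have t2 := (hends (i + 1) (by omega)).mono hai hei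
    have hm : ∀ t ∈ P i, s i < t ∧ t < s (i + 1) := fun t ht => ((hPmem i t).1 ht).2
    rw [(hpure i hi).segCost_eq hy le_rfl le_rfl, (hpure i hi).segmCost_eq hy le_rfl (P i)
      fun t ht => ⟨(hm t ht).1.le, (hm t ht).2.le⟩]
    split_ifs with hb
    · exact segCost_le_segmCost_of_gain_le hh t1 t2 (hPsort i) hm hb.1
        fun p t q h1 h2 h3 h4 => hG p t q (by omega) h2 h3 (by omega)
    · rw [add_zero]
      refine segCost_le_segmCost_of_tame hh (hlt' _ _ (by omega) (by omega)) t1 t2 (hPsort i) hm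
        (hPlen i hi) fun h2 => ?_
      -- Two changepoints exclude the outer stretches, so both ends of this one are true changes and
      -- a changepoint within `Δ` of an end is tame.
      have hi0 : i ≠ 0 := by rintro rfl; omega
      have hir : i ≠ r := by rintro rfl; omega
      have hi1 : 1 ≤ i := Nat.one_le_iff_ne_zero.2 hi0
      simp only [hbad, not_and, not_forall] at hb
      obtain ⟨t, ht, hb⟩ := hb h2
      refine ⟨t, ht, Tame.mono ?_ hai hei⟩
      have := hm t ht
      by_cases hc : s i + Δ ≤ t
      · obtain ⟨j, -, hj⟩ := hsτ (i + 1) (by omega) (by omega)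
        exact htame' j t (by omega) (by omega) (by omega) (by omega)
      · obtain ⟨j, -, hj⟩ := hsτ i hi1 hi
        exact htame' j t (by omega) (by omega) (by omega) (by omega)
  set b := ((Finset.range (r + 1)).filter bad).card with hb
  have hsum : ∑ i ∈ Finset.range (r + 1), segCost y (s i) (s (i + 1)) ≤
      segmCost y a T e + (r + 1) * (3 * h) + b * G := by
    have h1 := sum_segmCost_le y s r hmono T hT.sorted (fun t ht => by
      rw [hs0, hs1]; exact hT.mem t ht)
    have h2 := Finset.sum_le_sum hloss
    rw [Finset.sum_add_distrib, Finset.sum_add_distrib, ← Finset.sum_filter, Finset.sum_const,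
      Finset.sum_const, Finset.card_range, nsmul_eq_mul, nsmul_eq_mul] at h2
    rw [hs0, hs1] at h1
    push_cast at h2
    linarith
  have hopt := hT.le ((List.range' 1 r).map s) (by
      rw [List.pairwise_map]
      refine (List.pairwise_lt_range' (s := 1) (n := r)).imp_of_mem fun hx hz hxz => ?_
      simp only [List.mem_range'_1] at hx hz
      exact hlt' _ _ hxz (by omega))
    (fun t ht => by
      obtain ⟨i, hi, rfl⟩ := List.mem_map.1 ht
      simp only [List.mem_range'_1] at hi
      have h1 := hlt' 0 i (by omega) (by omega)
      have h2 := hlt' i (r + 1) (by omega) (by omega)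
      exact ⟨by omega, by omega⟩)
  have hcost : segmCost y a ((List.range' 1 r).map s) e =
      ∑ i ∈ Finset.range (r + 1), segCost y (s i) (s (i + 1)) := by
    rw [← segmCost_map_range', hs0, hs1]
  simp only [penCost, hcost, List.length_map, List.length_range'] at hopt
  -- The first and the last change are left out because the window of radius `Δ` around them may
  -- leave the chunk. The windows of the others fit, by the spacing `2 * Δ`.
  have hnear : ∀ i ∈ Finset.Icc 2 (r - 1), ∃ t ∈ T, s i < t + Δ ∧ t < s i + Δ := by
    intro i hi
    rw [Finset.mem_Icc] at hi
    obtain ⟨j, -, hj⟩ := hsτ i (by omega) (by omega)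
    have g1 := hgap 1 i le_rfl (by omega) (by omega)
    have g2 := hgap i r (by omega) (by omega) le_rfl
    have g3 := hlt' 0 1 (by omega) (by omega)
    have g4 := hlt' r (r + 1) (by omega) (by omega)
    obtain ⟨t, ht, h1, h2⟩ := hT.exists_near hβ0 (u := τ j - Δ) (s := τ j) (w := τ j + Δ)
      (by omega) (by omega) (by omega) (by omega) (hloc j (by omega) (by omega))
    exact ⟨t, ht, by omega, by omega⟩
  have hcard : T.toFinset.card = T.length :=
    List.toFinset_card_of_nodup (hT.sorted.imp fun h => h.ne)
  -- The changepoints near the inner changes lie in disjoint windows, and none of them is among the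
  -- two in a bad stretch, which stay away from every change.
  have hcount : r - 2 + b * 2 ≤ T.length := by
    set Wd : ℕ → Finset ℕ := fun i => T.toFinset.filter fun t => s i < t + Δ ∧ t < s i + Δ with hWd
    have hWmem : ∀ i t, t ∈ Wd i ↔ t ∈ T ∧ s i < t + Δ ∧ t < s i + Δ := by simp [hWd]
    have c1 : r - 2 ≤ ((Finset.Icc 2 (r - 1)).biUnion Wd).card := by
      rw [Finset.card_biUnion]
      · calc r - 2 = ∑ i ∈ Finset.Icc 2 (r - 1), 1 := by simp; omega
          _ ≤ _ := Finset.sum_le_sum fun i hi => by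
            obtain ⟨t, ht, h1⟩ := hnear i hi
            exact Finset.card_pos.2 ⟨t, (hWmem i t).2 ⟨ht, h1⟩⟩
      · have key : ∀ i ∈ Finset.Icc 2 (r - 1), ∀ i' ∈ Finset.Icc 2 (r - 1), i < i' →
            Disjoint (Wd i) (Wd i') := by
          intro i hi i' hi' hii
          rw [Finset.mem_Icc] at hi hi'
          have := hgap i i' (by omega) hii (by omega)
          rw [Finset.disjoint_left]
          intro t ht ht'
          rw [hWmem] at ht ht'
          omega
        intro i hi i' hi' hne
        rcases lt_or_gt_of_ne hne with h | h
        · exact key i hi i' hi' h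
        · exact (key i' hi' i hi h).symm
    have c2 : b * 2 ≤ (((Finset.range (r + 1)).filter bad).biUnion
        fun i => (P i).toFinset).card := by
      rw [Finset.card_biUnion]
      · rw [hb, ← smul_eq_mul, ← Finset.sum_const]
        refine Finset.sum_le_sum fun i hi => ?_
        rw [List.toFinset_card_of_nodup ((hPsort i).imp fun h => h.ne)]
        exact (Finset.mem_filter.1 hi).2.1.ge
      · have key : ∀ i i', i ≤ r → i' ≤ r → i < i' →
            Disjoint (P i).toFinset (P i').toFinset := by
          intro i i' hi hi' hii
          have := hle' (i + 1) i' hii (by omega)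
          rw [Finset.disjoint_left]
          intro t ht ht'
          rw [List.mem_toFinset, hPmem] at ht ht'
          omega
        intro i hi i' hi' hne
        simp only [Finset.coe_filter, Finset.mem_range, Set.mem_ofPred_eq] at hi hi'
        rcases lt_or_gt_of_ne hne with h | h
        · exact key i i' (by omega) (by omega) h
        · exact (key i' i (by omega) (by omega) h).symm
    have c3 : Disjoint ((Finset.Icc 2 (r - 1)).biUnion Wd)
        (((Finset.range (r + 1)).filter bad).biUnion fun i => (P i).toFinset) := by
      rw [Finset.disjoint_left]
      intro t ht ht'
      simp only [Finset.mem_biUnion, Finset.mem_filter, Finset.mem_range, Finset.mem_Icc,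
        List.mem_toFinset] at ht ht'
      obtain ⟨i, hi, ht⟩ := ht
      obtain ⟨i', ⟨hi', hb'⟩, ht'⟩ := ht'
      rw [hWmem] at ht
      have h1 := hb'.2 t ht'
      rcases le_or_gt i i' with h2 | h2
      · have := hle' i i' h2 (by omega); omega
      · have := hle' (i' + 1) i h2 (by omega); omega
    have c4 : (Finset.Icc 2 (r - 1)).biUnion Wd ∪
        (((Finset.range (r + 1)).filter bad).biUnion fun i => (P i).toFinset) ⊆ T.toFinset := by
      intro t ht
      simp only [Finset.mem_union, Finset.mem_biUnion, List.mem_toFinset] at ht ⊢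
      rcases ht with ⟨i, -, ht⟩ | ⟨i, -, ht⟩
      · exact ((hWmem i t).1 ht).1
      · exact ((hPmem i t).1 ht).1
    rw [← hcard]
    refine le_trans ?_ (Finset.card_le_card c4)
    rw [Finset.card_union_of_disjoint c3]
    omega
  have hb0 : r ≤ 1 → b = 0 := by
    intro h1
    rw [hb, Finset.card_eq_zero, Finset.filter_eq_empty_iff]
    intro i hi hbi
    rw [Finset.mem_range] at hi
    have h2 := hbi.1
    rcases Nat.eq_zero_or_pos i with rfl | h3
    · omega
    · have : i = r := by omega
      subst this; omega
  -- For `r ≥ 2`: the count `r - 2 + 2 * b` suffices if `b ≥ 2`, and the assumed excess changepoint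
  -- settles `b ≤ 1`.
  have hbk : b + r ≤ T.length := by
    rcases le_or_gt r 1 with h1 | h1
    · rw [hb0 h1]; omega
    · omega
  have e1 : (b : ℝ) + r ≤ T.length := by exact_mod_cast hbk
  -- With `k = T.length - r ≥ 1` excess changepoints and `b ≤ k`, optimality gives `k * (β - G) ≤ (m
  -- + 1) * (3 * h)`, against the choice of `β`.
  have e2 : (r : ℝ) + 1 ≤ T.length := by exact_mod_cast hlt
  have e3 : (r : ℝ) ≤ m := by exact_mod_cast hSm
  have e4 : (r + 1 : ℝ) * (3 * h) ≤ (m + 1) * (3 * h) := by gcongr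
  have e5 : b * G ≤ (T.length - r) * G := by gcongr; linarith
  have e6 : 1 * (β - G) ≤ (T.length - r : ℝ) * (β - G) := by
    apply mul_le_mul_of_nonneg_right <;> linarith
  linarith

end Chunk

/-! ### Gaussian noise -/

section Noise

variable {Ω : Type*}

/-- The information contained in `Z i`, `i ∈ A`. -/
@[reducible]
def sigmaOf (Z : ℕ → Ω → ℝ) (A : Finset ℕ) : MeasurableSpace Ω :=
  ⨆ i ∈ (A : Set ℕ), MeasurableSpace.comap (Z i) inferInstance

lemma measurable_sigmaOf (Z : ℕ → Ω → ℝ) {A B : Finset ℕ} (h : B ⊆ A) :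
    Measurable[sigmaOf Z A] fun ω => ∑ i ∈ B, Z i ω := by
  refine Finset.measurable_fun_sum _ fun i hi => ?_
  have h1 : Measurable[MeasurableSpace.comap (Z i) inferInstance] (Z i) := comap_measurable _
  exact h1.mono (le_iSup₂_of_le (f := fun i (_ : i ∈ (A : Set ℕ)) =>
    MeasurableSpace.comap (Z i) inferInstance) i (by exact_mod_cast h hi) le_rfl) le_rfl

variable [mΩ : MeasurableSpace Ω] {P : Measure Ω}

/-! ### Maximal inequality -/

/-- **Lévy's maximal inequality**, for events: the first of the events `F 0, …, F K` that occurs is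
followed by `F K` with conditional probability at least `1 / 2`. -/
lemma measure_iUnion_le_two_mul (F D : ℕ → Set Ω) (K : ℕ)
    (hFD : ∀ l ≤ K, F l ∩ D l ⊆ F K) (hD : ∀ l ≤ K, 1 ≤ 2 * P (D l))
    (hm : ∀ l ≤ K, MeasurableSet (F l)) (hDm : ∀ l ≤ K, MeasurableSet (D l))
    (hind : ∀ l ≤ K, ∃ m₁ m₂ : MeasurableSpace Ω, Indep m₁ m₂ P ∧
      (∀ i ≤ l, MeasurableSet[m₁] (F i)) ∧ MeasurableSet[m₂] (D l)) :
    P {ω | ∃ l ≤ K, ω ∈ F l} ≤ 2 * P (F K) := by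
  classical
  -- `E l` says that `F l` is the first of the events to occur. It is independent of `D l`, and
  -- these disjoint events, each intersected with its `D l`, all lie in `F K`.
  set E : ℕ → Set Ω := fun l => F l ∩ ⋂ i ∈ Finset.range l, (F i)ᶜ with hE
  have hEm : ∀ l ∈ Finset.range (K + 1), MeasurableSet (E l) := by
    intro l hl
    rw [Finset.mem_range] at hl
    refine (hm l (by omega)).inter (Finset.measurableSet_biInter _ fun i hi => ?_)
    rw [Finset.mem_range] at hi
    exact (hm i (by omega)).compl
  have hdisj : Pairwise (Function.onFun Disjoint E) := by
    have key : ∀ i j, i < j → Disjoint (E i) (E j) := by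
      intro i j hij
      rw [Set.disjoint_left]
      intro ω h1 h2
      exact (Set.mem_iInter₂.1 h2.2 i (Finset.mem_range.2 hij)) h1.1
    intro i j hij
    rcases lt_or_gt_of_ne hij with h | h
    · exact key i j h
    · exact (key j i h).symm
  have hsub : {ω | ∃ l ≤ K, ω ∈ F l} ⊆ ⋃ l ∈ Finset.range (K + 1), E l := by
    rintro ω ⟨l, hl, hω⟩
    have hex : ∃ l, ω ∈ F l := ⟨l, hω⟩
    simp only [Set.mem_iUnion, Finset.mem_range]
    refine ⟨Nat.find hex, by have := Nat.find_min' hex hω; omega, Nat.find_spec hex, ?_⟩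
    simp only [Set.mem_iInter, Finset.mem_range]
    exact fun i hi => Nat.find_min hex hi
  have hbound : ∀ l ∈ Finset.range (K + 1), P (E l) ≤ 2 * P (E l ∩ D l) := by
    intro l hl
    rw [Finset.mem_range] at hl
    obtain ⟨m₁, m₂, hi, h1, h2⟩ := hind l (by omega)
    have hE1 : MeasurableSet[m₁] (E l) := by
      refine (h1 l le_rfl).inter (Finset.measurableSet_biInter _ fun i hi => ?_)
      rw [Finset.mem_range] at hi
      exact (h1 i hi.le).compl
    rw [(Indep_iff m₁ m₂ P).1 hi _ _ hE1 h2]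
    calc P (E l) = P (E l) * 1 := (mul_one _).symm
      _ ≤ P (E l) * (2 * P (D l)) := by gcongr; exact hD l (by omega)
      _ = _ := by ring
  calc P {ω | ∃ l ≤ K, ω ∈ F l} ≤ P (⋃ l ∈ Finset.range (K + 1), E l) := measure_mono hsub
    _ ≤ ∑ l ∈ Finset.range (K + 1), P (E l) := measure_biUnion_finset_le _ _
    _ ≤ ∑ l ∈ Finset.range (K + 1), 2 * P (E l ∩ D l) := Finset.sum_le_sum hbound
    _ = 2 * P (⋃ l ∈ Finset.range (K + 1), E l ∩ D l) := by
      rw [measure_biUnion_finset, Finset.mul_sum]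
      · exact fun i _ j _ hij => (hdisj hij).mono Set.inter_subset_left Set.inter_subset_left
      · intro l hl
        refine (hEm l hl).inter (hDm l ?_)
        rw [Finset.mem_range] at hl
        omega
    _ ≤ 2 * P (F K) := by
      gcongr
      simp only [Set.iUnion_subset_iff, Finset.mem_range]
      intro l hl
      exact (Set.inter_subset_inter_left _ Set.inter_subset_left).trans (hFD l (by omega))

/-- Independent centred Gaussian variables of the same variance. -/
structure IsNoise (P : Measure Ω) (v : ℝ≥0) (Z : ℕ → Ω → ℝ) : Prop where
  meas : ∀ i, Measurable (Z i)
  law : ∀ i, HasLaw (Z i) (gaussianReal 0 v) P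
  indep : iIndepFun Z P

lemma IsNoise.indep_sigmaOf {v : ℝ≥0} {Z : ℕ → Ω → ℝ} (hZ : IsNoise P v Z) {A B : Finset ℕ}
    (h : Disjoint A B) : Indep (sigmaOf Z A) (sigmaOf Z B) P :=
  indep_iSup_of_disjoint (fun i => (hZ.meas i).comap_le) hZ.indep (by exact_mod_cast h)

lemma IsNoise.map_sum [IsProbabilityMeasure P] {v : ℝ≥0} {Z : ℕ → Ω → ℝ} (hZ : IsNoise P v Z)
    (A : Finset ℕ) : P.map (fun ω => ∑ i ∈ A, Z i ω) = gaussianReal 0 (A.card * v) := by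
  induction A using Finset.induction_on with
  | empty => simp [Measure.map_const]
  | insert a A ha ih =>
    have hind : IndepFun (Z a) (fun ω => ∑ i ∈ A, Z i ω) P := by
      have := (hZ.indep.indepFun_finsetSum_of_notMem hZ.meas ha).symm
      convert this using 1
      ext ω
      simp
    have := gaussianReal_add_gaussianReal_of_indepFun hind (hZ.law a).map_eq ih
    rw [Finset.card_insert_of_notMem ha]
    convert this using 2
    · ext ω; simp [Finset.sum_insert ha]
    · simp
    · push_cast; ring

/-- By symmetry of the law; this provides the events `D l` of Lévy's inequality. -/
lemma IsNoise.one_le_two_mul_measure [IsProbabilityMeasure P] {v : ℝ≥0} {Z : ℕ → Ω → ℝ}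
    (hZ : IsNoise P v Z) (A : Finset ℕ) (c : ℝ) : 1 ≤ 2 * P {ω | 0 ≤ c * ∑ i ∈ A, Z i ω} := by
  have hmeas : Measurable fun ω => ∑ i ∈ A, Z i ω :=
    Finset.measurable_fun_sum _ fun i _ => hZ.meas i
  set ν := gaussianReal 0 (A.card * v) with hν
  have hmap := hZ.map_sum A
  have hs1 : P {ω | 0 ≤ c * ∑ i ∈ A, Z i ω} = ν {x | 0 ≤ c * x} := by
    rw [hν, ← hmap, Measure.map_apply hmeas (measurableSet_le measurable_const (by fun_prop))]
    rfl
  have hs2 : ν {x | 0 ≤ c * x} = ν {x | c * x ≤ 0} := by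
    conv_lhs => rw [hν, show (0 : ℝ) = -0 by simp, ← gaussianReal_map_neg,
      Measure.map_apply measurable_neg (measurableSet_le measurable_const (by fun_prop))]
    rw [hν]
    congr 1
    ext x
    simp
  have hprob : ν Set.univ = 1 := measure_univ
  have hun : (Set.univ : Set ℝ) ⊆ {x | 0 ≤ c * x} ∪ {x | c * x ≤ 0} := fun x _ =>
    le_total 0 (c * x)
  calc (1 : ℝ≥0∞) = ν Set.univ := hprob.symm
    _ ≤ ν {x | 0 ≤ c * x} + ν {x | c * x ≤ 0} := (measure_mono hun).trans (measure_union_le _ _)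
    _ = 2 * P {ω | 0 ≤ c * ∑ i ∈ A, Z i ω} := by rw [← hs2, hs1]; ring

lemma IsNoise.hasSubgaussianMGF_sum [IsProbabilityMeasure P] {v : ℝ≥0} {Z : ℕ → Ω → ℝ}
    (hZ : IsNoise P v Z) (A : Finset ℕ) :
    HasSubgaussianMGF (fun ω => ∑ i ∈ A, Z i ω) (A.card * v) P := by
  have hmeas : Measurable fun ω => ∑ i ∈ A, Z i ω :=
    Finset.measurable_fun_sum _ fun i _ => hZ.meas i
  constructor
  · intro t
    have h1 := integrable_exp_mul_gaussianReal (μ := 0) (v := A.card * v) t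
    rw [← hZ.map_sum A, integrable_map_measure (by fun_prop) hmeas.aemeasurable] at h1
    exact h1
  · intro t
    rw [mgf_gaussianReal (hZ.map_sum A)]
    simp

/-- Gaussian tail of a combination of two independent sums of noise. -/
lemma IsNoise.measure_le_exp [IsProbabilityMeasure P] {v : ℝ≥0} {Z : ℕ → Ω → ℝ}
    (hZ : IsNoise P v Z) {A B : Finset ℕ} (hAB : Disjoint A B) {c₁ c₂ x V : ℝ} (hx : 0 ≤ x)
    (hV : v * (c₁ ^ 2 * A.card + c₂ ^ 2 * B.card) ≤ V) :
    P {ω | x ≤ c₁ * ∑ i ∈ A, Z i ω + c₂ * ∑ i ∈ B, Z i ω} ≤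
      ENNReal.ofReal (Real.exp (-x ^ 2 / (2 * V))) := by
  have hV0 : 0 ≤ V := le_trans (by positivity) hV
  lift V to ℝ≥0 using hV0
  have hind : IndepFun (fun ω => c₁ * ∑ i ∈ A, Z i ω) (fun ω => c₂ * ∑ i ∈ B, Z i ω) P := by
    have hi := hZ.indep_sigmaOf hAB
    rw [IndepFun_iff_Indep]
    refine indep_of_indep_of_le_left (indep_of_indep_of_le_right hi ?_) ?_
    · exact ((measurable_sigmaOf Z (Finset.Subset.refl B)).const_mul c₂).comap_le
    · exact ((measurable_sigmaOf Z (Finset.Subset.refl A)).const_mul c₁).comap_le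
  have h := ((hZ.hasSubgaussianMGF_sum A).const_mul c₁).add_of_indepFun
    ((hZ.hasSubgaussianMGF_sum B).const_mul c₂) hind
  have h' : HasSubgaussianMGF (fun ω => c₁ * ∑ i ∈ A, Z i ω + c₂ * ∑ i ∈ B, Z i ω) V P := by
    refine ⟨h.integrable_exp_mul, fun t => (h.mgf_le t).trans ?_⟩
    rw [Real.exp_le_exp]
    gcongr
    rw [← NNReal.coe_le_coe]
    push_cast
    refine le_trans (le_of_eq ?_) hV
    change c₁ ^ 2 * ((A.card : ℝ) * v) + c₂ ^ 2 * ((B.card : ℝ) * v) = _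
    ring
  rw [← ofReal_measureReal]
  exact ENNReal.ofReal_le_ofReal (h'.measure_ge_le hx)

/-- Maximal inequality for the sums of noise to the left and to the right of `b`. -/
lemma IsNoise.measure_max_le [IsProbabilityMeasure P] {v : ℝ≥0} {Z : ℕ → Ω → ℝ}
    (hZ : IsNoise P v Z) {b K₁ K₂ : ℕ} (hb : K₁ ≤ b) {c₁ c₂ x V : ℝ} (hx : 0 ≤ x)
    (hV : v * (c₁ ^ 2 * K₁ + c₂ ^ 2 * K₂) ≤ V) :
    P {ω | ∃ k ≤ K₁, ∃ l ≤ K₂, x ≤ c₁ * ∑ i ∈ Finset.Ioc (b - k) b, Z i ω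
        + c₂ * ∑ i ∈ Finset.Ioc b (b + l), Z i ω} ≤
      4 * ENNReal.ofReal (Real.exp (-x ^ 2 / (2 * V))) := by
  set X : ℕ → ℕ → Ω → ℝ := fun k l ω => c₁ * ∑ i ∈ Finset.Ioc (b - k) b, Z i ω
        + c₂ * ∑ i ∈ Finset.Ioc b (b + l), Z i ω with hX
  have hXm : ∀ (A : Finset ℕ) (k l : ℕ), Finset.Ioc (b - k) (b + l) ⊆ A →
      Measurable[sigmaOf Z A] (X k l) := by
    intro A k l hA
    have h1 : Measurable[sigmaOf Z A] fun ω => ∑ i ∈ Finset.Ioc (b - k) b, Z i ω :=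
      measurable_sigmaOf Z ((Finset.Ioc_subset_Ioc_right (by omega)).trans hA)
    have h2 : Measurable[sigmaOf Z A] fun ω => ∑ i ∈ Finset.Ioc b (b + l), Z i ω :=
      measurable_sigmaOf Z ((Finset.Ioc_subset_Ioc_left (by omega)).trans hA)
    exact (h1.const_mul c₁).add (h2.const_mul c₂)
  have hle : ∀ A : Finset ℕ, sigmaOf Z A ≤ mΩ := fun A => iSup₂_le fun i _ => (hZ.meas i).comap_le
  have hset : ∀ (A : Finset ℕ) (k l : ℕ), Finset.Ioc (b - k) (b + l) ⊆ A →
      MeasurableSet[sigmaOf Z A] {ω | x ≤ X k l ω} := fun A k l hA =>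
    (hXm A k l hA) measurableSet_Ici
  have hsetD : ∀ (A : Finset ℕ) (c : ℝ), MeasurableSet[sigmaOf Z A] {ω | 0 ≤ c * ∑ i ∈ A, Z i ω} :=
    fun A c => ((measurable_sigmaOf Z (Finset.Subset.refl A)).const_mul c) measurableSet_Ici
  have hsetF : ∀ (A : Finset ℕ) (k : ℕ), Finset.Ioc (b - k) (b + K₂) ⊆ A →
      MeasurableSet[sigmaOf Z A] {ω | ∃ l ≤ K₂, x ≤ X k l ω} := by
    intro A k hA
    have : {ω | ∃ l ≤ K₂, x ≤ X k l ω} = ⋃ l ∈ Finset.range (K₂ + 1), {ω | x ≤ X k l ω} := by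
      ext ω; simp
    rw [this]
    refine Finset.measurableSet_biUnion _ fun l hl => hset A k l (subset_trans ?_ hA)
    rw [Finset.mem_range] at hl
    exact Finset.Ioc_subset_Ioc_right (by omega)
  -- Lévy's inequality for the left arm, the event at stage `k` being that some right arm works. The
  -- rest of the left arm is independent of all noise used so far, and completes the arm without
  -- lowering the sum when its contribution is nonnegative.
  have step1 : P {ω | ∃ k ≤ K₁, ω ∈ {ω | ∃ l ≤ K₂, x ≤ X k l ω}} ≤
      2 * P {ω | ∃ l ≤ K₂, x ≤ X K₁ l ω} := by
    refine measure_iUnion_le_two_mul (fun k => {ω | ∃ l ≤ K₂, x ≤ X k l ω})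
      (fun k => {ω | 0 ≤ c₁ * ∑ i ∈ Finset.Ioc (b - K₁) (b - k), Z i ω}) K₁ ?_
      (fun k _ => hZ.one_le_two_mul_measure _ _) (fun k _ => hle _ _ (hsetF _ k subset_rfl))
      (fun k _ => hle _ _ (hsetD _ _)) ?_
    · rintro k hk ω ⟨⟨l, hl, h1⟩, h2⟩
      refine ⟨l, hl, ?_⟩
      simp only [Set.mem_ofPred_eq, hX] at h1 h2 ⊢
      rw [sum_Ioc_split (fun i => Z i ω) (a := b - K₁) (b := b - k) (c := b) (by omega) (by omega)]
      linarith
    · intro k hk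
      refine ⟨sigmaOf Z (Finset.Ioc (b - k) (b + K₂)), sigmaOf Z (Finset.Ioc (b - K₁) (b - k)),
        hZ.indep_sigmaOf (Finset.Ioc_disjoint_Ioc_of_le le_rfl).symm, fun i hi => ?_, hsetD _ _⟩
      exact hsetF _ i (Finset.Ioc_subset_Ioc_left (by omega))
  have step2 : P {ω | ∃ l ≤ K₂, ω ∈ {ω | x ≤ X K₁ l ω}} ≤ 2 * P {ω | x ≤ X K₁ K₂ ω} := by
    refine measure_iUnion_le_two_mul (fun l => {ω | x ≤ X K₁ l ω})
      (fun l => {ω | 0 ≤ c₂ * ∑ i ∈ Finset.Ioc (b + l) (b + K₂), Z i ω}) K₂ ?_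
      (fun k _ => hZ.one_le_two_mul_measure _ _) (fun k _ => hle _ _ (hset _ K₁ k subset_rfl))
      (fun k _ => hle _ _ (hsetD _ _)) ?_
    · rintro l hl ω ⟨h1, h2⟩
      simp only [Set.mem_ofPred_eq, hX] at h1 h2 ⊢
      rw [sum_Ioc_split (fun i => Z i ω) (a := b) (b := b + l) (c := b + K₂) (by omega) (by omega)]
      linarith
    · intro l hl
      refine ⟨sigmaOf Z (Finset.Ioc (b - K₁) (b + l)), sigmaOf Z (Finset.Ioc (b + l) (b + K₂)),
        hZ.indep_sigmaOf (Finset.Ioc_disjoint_Ioc_of_le le_rfl), fun i hi => ?_, hsetD _ _⟩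
      exact hset _ K₁ i (Finset.Ioc_subset_Ioc_right (by omega))
  have step3 : P {ω | x ≤ X K₁ K₂ ω} ≤ ENNReal.ofReal (Real.exp (-x ^ 2 / (2 * V))) := by
    refine hZ.measure_le_exp (Finset.Ioc_disjoint_Ioc_of_le le_rfl) hx ?_
    rw [Nat.card_Ioc, Nat.card_Ioc, Nat.sub_sub_self hb, Nat.add_sub_cancel_left]
    exact hV
  calc _ ≤ 2 * P {ω | ∃ l ≤ K₂, x ≤ X K₁ l ω} := step1
    _ ≤ 2 * (2 * P {ω | x ≤ X K₁ K₂ ω}) := by gcongr; exact step2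
    _ ≤ 2 * (2 * ENNReal.ofReal (Real.exp (-x ^ 2 / (2 * V)))) := by gcongr
    _ = _ := by rw [← mul_assoc]; norm_num

/-! ### Uniform bounds for the noise -/

lemma measure_biUnion_le_card_mul {ι : Type*} (s : Finset ι) (A : ι → Set Ω) (x : ℝ≥0∞)
    (h : ∀ i ∈ s, P (A i) ≤ x) : P (⋃ i ∈ s, A i) ≤ s.card * x := by
  refine (measure_biUnion_finset_le s A).trans ((Finset.sum_le_sum h).trans ?_)
  simp

/-- Replaces the mean over an arm of variable length `k` by a sum with the fixed factor `c / p`, as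
the maximal inequality requires. A negative contribution is replaced by the empty arm. -/
lemma exists_le_div_mul {S : ℕ → ℝ} (hS : S 0 = 0) (c : ℝ) {p : ℝ} (hp : 0 < p) {k K : ℕ}
    (hpk : p ≤ k) (hk : k ≤ K) : ∃ k' ≤ K, c * (S k / k) ≤ c / p * S k' := by
  have hk0 : (0 : ℝ) < k := hp.trans_le hpk
  rcases le_or_gt 0 (c * S k) with h | h
  · refine ⟨k, hk, ?_⟩
    rw [← mul_div_assoc, div_mul_eq_mul_div]
    gcongr
  · refine ⟨0, by omega, ?_⟩
    rw [hS, mul_zero, ← mul_div_assoc]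
    exact (div_neg_of_neg_of_pos h hk0).le

lemma exists_sign_of_lt_sq {x w : ℝ} (h : x < w ^ 2) :
    ∃ c ∈ ({1, -1} : Finset ℝ), √x ≤ c * w := by
  have h1 : √x ≤ |w| := by
    rw [← Real.sqrt_sq_eq_abs]; exact Real.sqrt_le_sqrt h.le
  rcases abs_choice w with h2 | h2 <;> rw [h2] at h1
  · exact ⟨1, by simp, by linarith⟩
  · exact ⟨-1, by simp, by linarith⟩

lemma exists_pow_le_lt {ρ : ℝ} (hρ : 1 < ρ) {n K k : ℕ} (hK : (n : ℝ) < ρ ^ K) (hk : 1 ≤ k)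
    (hkn : k ≤ n) : ∃ i ∈ Finset.range K, ρ ^ i ≤ k ∧ k ≤ ⌊ρ ^ (i + 1)⌋₊ ∧
      (k : ℝ) < ρ ^ (i + 1) := by
  obtain ⟨i, h1, h2⟩ := exists_nat_pow_near (x := (k : ℝ)) (by exact_mod_cast hk) hρ
  refine ⟨i, ?_, h1, Nat.le_floor h2.le, h2⟩
  rw [Finset.mem_range]
  have : ρ ^ i < ρ ^ K := h1.trans_lt (lt_of_le_of_lt (by exact_mod_cast hkn) hK)
  exact (pow_lt_pow_iff_right₀ hρ).1 this

/-- The factor `n` counts the middle points, `K * K` the scales of the two arms, `2` the signs and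
`4` comes from the maximal inequality. Grouping lengths by scale costs only the factor `ρ ^ 2` in
the exponent, and `ρ` may be close to one. -/
lemma IsNoise.measure_gain_le [IsProbabilityMeasure P] {v : ℝ≥0} (hv : 0 < v) {Z : ℕ → Ω → ℝ}
    (hZ : IsNoise P v Z) {ρ : ℝ} (hρ : 1 < ρ) {n K : ℕ} (hK : (n : ℝ) < ρ ^ K) {G : ℝ}
    (hG : 0 ≤ G) :
    P {ω | ∃ a b c, a < b ∧ b < c ∧ c ≤ n ∧ G < gain (fun i => Z i ω) a b c} ≤
      n * (K * (K * (2 * (4 * ENNReal.ofReal (Real.exp (-G / (2 * v * ρ ^ 2))))))) := by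
  have hρ0 : 0 < ρ := by linarith
  set C : ℕ → ℕ → ℕ → ℝ → Set Ω := fun b i j c =>
    {ω | ∃ k ≤ min ⌊ρ ^ (i + 1)⌋₊ b, ∃ l ≤ ⌊ρ ^ (j + 1)⌋₊,
      √(G * (1 / ρ ^ i + 1 / ρ ^ j) / ρ) ≤ c / ρ ^ i * ∑ i ∈ Finset.Ioc (b - k) b, Z i ω
        + -c / ρ ^ j * ∑ i ∈ Finset.Ioc b (b + l), Z i ω} with hC
  have hsub : {ω | ∃ a b c, a < b ∧ b < c ∧ c ≤ n ∧ G < gain (fun i => Z i ω) a b c} ⊆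
      ⋃ b ∈ Finset.range n, ⋃ i ∈ Finset.range K, ⋃ j ∈ Finset.range K,
        ⋃ c ∈ ({1, -1} : Finset ℝ), C b i j c := by
    rintro ω ⟨a, b, c, hab, hbc, hcn, hgain⟩
    obtain ⟨k, rfl⟩ := Nat.exists_eq_add_of_lt hab
    obtain ⟨l, rfl⟩ := Nat.exists_eq_add_of_lt hbc
    set b := a + k + 1 with hb
    obtain ⟨i, hi, hi1, hi2, hi3⟩ := exists_pow_le_lt hρ hK (k := k + 1) (by omega) (by omega)
    obtain ⟨j, hj, hj1, hj2, hj3⟩ := exists_pow_le_lt hρ hK (k := l + 1) (by omega) (by omega)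
    have hk0 : (0 : ℝ) < ((k + 1 : ℕ) : ℝ) := by positivity
    have hl0 : (0 : ℝ) < ((l + 1 : ℕ) : ℝ) := by positivity
    have hba : (b : ℝ) - a = ((k + 1 : ℕ) : ℝ) := by rw [hb]; push_cast; ring
    have hcb : ((b + l + 1 : ℕ) : ℝ) - b = ((l + 1 : ℕ) : ℝ) := by push_cast; ring
    rw [gain_eq _ hab hbc, hba, hcb, lt_div_iff₀ (by positivity)] at hgain
    obtain ⟨c, hc, hle⟩ := exists_sign_of_lt_sq hgain
    obtain ⟨k', hk', hk''⟩ := exists_le_div_mul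
      (S := fun k => ∑ i ∈ Finset.Ioc (b - k) b, Z i ω) (by simp) c (pow_pos hρ0 i) hi1
      (le_min hi2 (by omega : k + 1 ≤ b))
    obtain ⟨l', hl', hl''⟩ := exists_le_div_mul
      (S := fun l => ∑ i ∈ Finset.Ioc b (b + l), Z i ω) (by simp) (-c) (pow_pos hρ0 j) hj1 hj2
    simp only [Set.mem_iUnion]
    refine ⟨b, Finset.mem_range.2 (by omega), i, hi, j, hj, c, hc, k', hk', l', hl', ?_⟩
    rw [show b - (k + 1) = a by omega] at hk''
    -- The arms are shorter than `ρ ^ (i + 1)` and `ρ ^ (j + 1)`; this loses one factor `ρ` in the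
    -- threshold. The other one is lost in the variance bound.
    have h1 : √(G * (1 / ρ ^ i + 1 / ρ ^ j) / ρ) ≤
        √(G * (1 / ((k + 1 : ℕ) : ℝ) + 1 / ((l + 1 : ℕ) : ℝ))) := by
      apply Real.sqrt_le_sqrt
      rw [mul_div_assoc, add_div, div_div, div_div, ← pow_succ, ← pow_succ]
      gcongr
    rw [show b + (l + 1) = b + l + 1 by omega] at hl''
    rw [mul_sub] at hle
    linarith
  refine (measure_mono hsub).trans ?_
  conv_rhs => rw [← Finset.card_range n, ← Finset.card_range K]
  refine measure_biUnion_le_card_mul _ _ _ fun b _ => measure_biUnion_le_card_mul _ _ _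
    fun i _ => measure_biUnion_le_card_mul _ _ _ fun j _ => ?_
  have hcard : ((({1, -1} : Finset ℝ).card : ℕ) : ℝ≥0∞) = 2 := by
    rw [Finset.card_pair (by norm_num)]; norm_num
  rw [← hcard]
  refine measure_biUnion_le_card_mul _ _ _ fun c hc => ?_
  have hc2 : c ^ 2 = 1 := by
    simp only [Finset.mem_insert, Finset.mem_singleton] at hc
    rcases hc with rfl | rfl <;> norm_num
  have hi : (0 : ℝ) < ρ ^ i := by positivity
  have hj : (0 : ℝ) < ρ ^ j := by positivity
  have hv' : (0 : ℝ) < v := by exact_mod_cast hv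
  refine (hZ.measure_max_le (V := v * ρ * (1 / ρ ^ i + 1 / ρ ^ j)) (min_le_right _ _)
    (Real.sqrt_nonneg _) ?_).trans ?_
  · have f1 : ((min ⌊ρ ^ (i + 1)⌋₊ b : ℕ) : ℝ) ≤ ρ ^ (i + 1) :=
      le_trans (by exact_mod_cast min_le_left _ _) (Nat.floor_le (by positivity))
    have f2 : (⌊ρ ^ (j + 1)⌋₊ : ℝ) ≤ ρ ^ (j + 1) := Nat.floor_le (by positivity)
    calc _ ≤ v * ((c / ρ ^ i) ^ 2 * ρ ^ (i + 1) + (-c / ρ ^ j) ^ 2 * ρ ^ (j + 1)) := by gcongr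
      _ = c ^ 2 * (v * ρ * (1 / ρ ^ i + 1 / ρ ^ j)) := by field_simp; ring
      _ = _ := by rw [hc2, one_mul]
  · gcongr 4 * ENNReal.ofReal (Real.exp ?_)
    rw [Real.sq_sqrt (by positivity)]
    apply le_of_eq
    field_simp

/-- With the endpoint `p` fixed there is no factor `n`, so even a small multiple of `log n` as `h`
gives a negative power of `n`. -/
lemma IsNoise.measure_not_tame_le [IsProbabilityMeasure P] {v : ℝ≥0} (hv : 0 < v) {Z : ℕ → Ω → ℝ}
    (hZ : IsNoise P v Z) {ρ : ℝ} (hρ : 1 < ρ) {n K : ℕ} (hK : (n : ℝ) < ρ ^ K) {h : ℝ}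
    (hh : 0 ≤ h) {p : ℕ} (hp : p ≤ n) :
    P {ω | ¬ Tame (fun i => Z i ω) h 0 n p} ≤
      K * (2 * (8 * ENNReal.ofReal (Real.exp (-h / (2 * v * ρ ^ 2))))) := by
  have hρ0 : 0 < ρ := by linarith
  set C₁ : ℕ → ℝ → Set Ω := fun i c =>
    {ω | ∃ k ≤ min ⌊ρ ^ (i + 1)⌋₊ p, ∃ l ≤ 0,
      √(h * ρ ^ i) ≤ c * ∑ i ∈ Finset.Ioc (p - k) p, Z i ω
        + 0 * ∑ i ∈ Finset.Ioc p (p + l), Z i ω} with hC₁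
  set C₂ : ℕ → ℝ → Set Ω := fun i c =>
    {ω | ∃ k ≤ 0, ∃ l ≤ ⌊ρ ^ (i + 1)⌋₊,
      √(h * ρ ^ i) ≤ 0 * ∑ i ∈ Finset.Ioc (p - k) p, Z i ω
        + c * ∑ i ∈ Finset.Ioc p (p + l), Z i ω} with hC₂
  have hsub : {ω | ¬ Tame (fun i => Z i ω) h 0 n p} ⊆
      ⋃ i ∈ Finset.range K, ⋃ c ∈ ({1, -1} : Finset ℝ), (C₁ i c ∪ C₂ i c) := by
    intro ω hω
    simp only [Tame, Set.mem_ofPred_eq, not_and_or, not_forall, not_le] at hω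
    rcases hω with ⟨t, ht, htn, hlt⟩ | ⟨t, -, ht, hlt⟩
    · obtain ⟨i, hi, hi1, hi2, -⟩ := exists_pow_le_lt hρ hK (k := t - p) (by omega) (by omega)
      obtain ⟨c, hc, hle⟩ := exists_sign_of_lt_sq hlt
      simp only [Set.mem_iUnion]
      refine ⟨i, hi, c, hc, Or.inr ⟨0, le_rfl, t - p, hi2, ?_⟩⟩
      rw [show p + (t - p) = t by omega, zero_mul, zero_add]
      refine le_trans (Real.sqrt_le_sqrt ?_) hle
      rw [Nat.cast_sub ht.le] at hi1
      gcongr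
    · obtain ⟨i, hi, hi1, hi2, -⟩ := exists_pow_le_lt hρ hK (k := p - t) (by omega) (by omega)
      obtain ⟨c, hc, hle⟩ := exists_sign_of_lt_sq hlt
      simp only [Set.mem_iUnion]
      refine ⟨i, hi, c, hc, Or.inl ⟨p - t, le_min hi2 (by omega), 0, le_rfl, ?_⟩⟩
      rw [show p - (p - t) = t by omega, zero_mul, add_zero]
      refine le_trans (Real.sqrt_le_sqrt ?_) hle
      rw [Nat.cast_sub ht.le] at hi1
      gcongr
  refine (measure_mono hsub).trans ?_
  conv_rhs => rw [← Finset.card_range K]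
  refine measure_biUnion_le_card_mul _ _ _ fun i _ => ?_
  have hcard : ((({1, -1} : Finset ℝ).card : ℕ) : ℝ≥0∞) = 2 := by
    rw [Finset.card_pair (by norm_num)]; norm_num
  rw [← hcard]
  refine measure_biUnion_le_card_mul _ _ _ fun c hc => ?_
  have hc2 : c ^ 2 = 1 := by
    simp only [Finset.mem_insert, Finset.mem_singleton] at hc
    rcases hc with rfl | rfl <;> norm_num
  have hi : (0 : ℝ) < ρ ^ i := by positivity
  have hv' : (0 : ℝ) < v := by exact_mod_cast hv
  -- The exponent `i + 1` would do; `i + 2` makes the exponential bound have the same form as the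
  -- one for gains.
  have f2 : (⌊ρ ^ (i + 1)⌋₊ : ℝ) ≤ ρ ^ (i + 2) :=
    (Nat.floor_le (by positivity)).trans (pow_le_pow_right₀ hρ.le (by omega))
  have f1 : ((min ⌊ρ ^ (i + 1)⌋₊ p : ℕ) : ℝ) ≤ ρ ^ (i + 2) :=
    le_trans (by exact_mod_cast min_le_left _ _) f2
  have hexp : ENNReal.ofReal (Real.exp (-√(h * ρ ^ i) ^ 2 / (2 * (v * ρ ^ (i + 2))))) =
      ENNReal.ofReal (Real.exp (-h / (2 * v * ρ ^ 2))) := by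
    congr 2
    rw [Real.sq_sqrt (by positivity)]
    field_simp
    ring
  have m1 : P (C₁ i c) ≤ 4 * ENNReal.ofReal (Real.exp (-h / (2 * v * ρ ^ 2))) := by
    rw [← hexp]
    refine hZ.measure_max_le (min_le_right _ _) (Real.sqrt_nonneg _) ?_
    rw [hc2]
    simp only [one_mul, CharP.cast_eq_zero, mul_zero, add_zero]
    gcongr
  have m2 : P (C₂ i c) ≤ 4 * ENNReal.ofReal (Real.exp (-h / (2 * v * ρ ^ 2))) := by
    rw [← hexp]
    refine hZ.measure_max_le (Nat.zero_le _) (Real.sqrt_nonneg _) ?_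
    rw [hc2]
    simp only [one_mul, CharP.cast_eq_zero, mul_zero, zero_add]
    gcongr
  calc P (C₁ i c ∪ C₂ i c) ≤ P (C₁ i c) + P (C₂ i c) := measure_union_le _ _
    _ ≤ _ := add_le_add m1 m2
    _ = _ := by rw [← add_mul]; norm_num

/-! ### Asymptotics -/

/-- The cumulative sums of the noise behave up to `n` as they typically do: no triple has a gain
exceeding `G`, and the sums from the points of `A` are at most of the order of the square root of
their length. -/
def Typical (W : ℕ → ℝ) (G h : ℝ) (n : ℕ) (A : Finset ℕ) : Prop :=
  (∀ a b c, a < b → b < c → c ≤ n → gain W a b c ≤ G) ∧ ∀ p ∈ A, p ≤ n → Tame W h 0 n p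

/-- Number of powers of `ρ` up to `n`. -/
noncomputable def numScales (ρ : ℝ) (n : ℕ) : ℕ := ⌊Real.log n / Real.log ρ⌋₊ + 1

lemma lt_pow_numScales {ρ : ℝ} (hρ : 1 < ρ) {n : ℕ} (hn : 1 ≤ n) :
    (n : ℝ) < ρ ^ numScales ρ n := by
  have hn' : (0 : ℝ) < n := by exact_mod_cast hn
  have hlog := Real.log_pos hρ
  rw [← Real.log_lt_log_iff hn' (by positivity), Real.log_pow, ← div_lt_iff₀ hlog]
  have := Nat.lt_floor_add_one (Real.log n / Real.log ρ)
  rw [numScales]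
  push_cast
  exact this

/-- Growth slower than every power of `n`. -/
def SubPolynomial (f : ℕ → ℝ) : Prop := ∀ η : ℝ, 0 < η → ∀ᶠ n : ℕ in atTop, f n ≤ (n : ℝ) ^ η

lemma subPolynomial_of_le_log {f : ℕ → ℝ} {c d : ℝ}
    (h : ∀ᶠ n : ℕ in atTop, f n ≤ c * Real.log n + d) : SubPolynomial f := by
  intro η hη
  have h1 : (fun n : ℕ => c * Real.log n + d) =o[atTop] fun n : ℕ => (n : ℝ) ^ η := by
    refine IsLittleO.add ?_ ?_
    · exact ((isLittleO_log_rpow_atTop hη).comp_tendsto tendsto_natCast_atTop_atTop).const_mul_left c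
    · refine isLittleO_const_left.2 (Or.inr ?_)
      exact tendsto_norm_atTop_atTop.comp
        ((tendsto_rpow_atTop hη).comp tendsto_natCast_atTop_atTop)
  filter_upwards [h, h1.bound one_pos] with n hn hn'
  rw [one_mul, Real.norm_eq_abs, Real.norm_eq_abs,
    abs_of_nonneg (Real.rpow_nonneg (Nat.cast_nonneg n) η)] at hn'
  exact hn.trans ((le_abs_self _).trans hn')

lemma subPolynomial_numScales {ρ : ℝ} (hρ : 1 < ρ) : SubPolynomial fun n => numScales ρ n := by
  refine subPolynomial_of_le_log (c := (Real.log ρ)⁻¹) (d := 1) ?_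
  filter_upwards [eventually_ge_atTop 1] with n hn
  have : 0 ≤ Real.log n / Real.log ρ :=
    div_nonneg (Real.log_natCast_nonneg n) (Real.log_pos hρ).le
  rw [numScales]
  push_cast
  have := Nat.floor_le this
  rw [div_eq_inv_mul] at this ⊢
  linarith

lemma tendsto_zero_of_subPolynomial {f g : ℕ → ℝ} (hf : SubPolynomial f) (hg : SubPolynomial g)
    (hf0 : ∀ n, 0 ≤ f n) (hg0 : ∀ n, 0 ≤ g n) {κ : ℝ} (hκ : 0 < κ) :
    Tendsto (fun n : ℕ => f n * g n * (n : ℝ) ^ (-κ)) atTop (𝓝 0) := by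
  have h0 : Tendsto (fun n : ℕ => (n : ℝ) ^ (-(κ / 2))) atTop (𝓝 0) :=
    (tendsto_rpow_neg_atTop (by positivity)).comp tendsto_natCast_atTop_atTop
  refine squeeze_zero' (Eventually.of_forall fun n => ?_) ?_ h0
  · exact mul_nonneg (mul_nonneg (hf0 n) (hg0 n)) (by positivity)
  · filter_upwards [hf (κ / 4) (by positivity), hg (κ / 4) (by positivity),
      eventually_ge_atTop 1] with n h1 h2 hn
    have hn' : (0 : ℝ) < n := by exact_mod_cast hn
    calc _ ≤ (n : ℝ) ^ (κ / 4) * (n : ℝ) ^ (κ / 4) * (n : ℝ) ^ (-κ) := by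
          gcongr
          exact hg0 n
      _ = _ := by
        rw [← Real.rpow_add hn', ← Real.rpow_add hn']
        congr 1
        ring

/-- The union over all middle points leaves `n ^ (1 - g / (2 * ρ ^ 2))` up to powers of `log n`,
which vanishes for `ρ` near one precisely because `2 < g`. Tameness fails with a negative power of
`n`, however small `δ` is, which beats a subpolynomial number of points. -/
lemma IsNoise.tendsto_not_typical [IsProbabilityMeasure P] {v : ℝ≥0} (hv : 0 < v)
    {Z : ℕ → Ω → ℝ} (hZ : IsNoise P v Z) {g δ : ℝ} (hg : 2 < g) (hδ : 0 < δ) (A : ℕ → Finset ℕ)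
    (hA : SubPolynomial fun n => (A n).card) :
    Tendsto (fun n : ℕ => P {ω | ¬ Typical (fun i => Z i ω) (g * v * Real.log n)
      (δ * v * Real.log n) n (A n)}) atTop (𝓝 0) := by
  -- The square of `ρ` is midway between `1` and `g / 2`, so that `1 < ρ` and `2 * ρ ^ 2 < g`.
  set ρ : ℝ := √((1 + g / 2) / 2) with hρdef
  have hρ2 : ρ ^ 2 = (1 + g / 2) / 2 := Real.sq_sqrt (by linarith)
  have hρ : 1 < ρ := by
    rw [hρdef]
    apply Real.lt_sqrt_of_sq_lt
    linarith
  have hρ0 : 0 < ρ := by linarith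
  have hv' : (0 : ℝ) < v := by exact_mod_cast hv
  have hexp : ∀ (x : ℝ) (n : ℕ), 1 ≤ n →
      Real.exp (-(x * v * Real.log n) / (2 * v * ρ ^ 2)) = (n : ℝ) ^ (-(x / (2 * ρ ^ 2))) := by
    intro x n hn
    rw [Real.rpow_def_of_pos (by exact_mod_cast hn)]
    congr 1
    field_simp
  have hκ : 0 < g / (2 * ρ ^ 2) - 1 := by
    rw [sub_pos, lt_div_iff₀ (by positivity), hρ2]
    linarith
  have hκ' : 0 < δ / (2 * ρ ^ 2) := by positivity
  have hK := subPolynomial_numScales hρ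
  have t1 := (tendsto_zero_of_subPolynomial hK hK (fun n => Nat.cast_nonneg _)
    (fun n => Nat.cast_nonneg _) hκ).const_mul 8
  have t2 := (tendsto_zero_of_subPolynomial hA hK (fun n => Nat.cast_nonneg _)
    (fun n => Nat.cast_nonneg _) hκ').const_mul 16
  have t3 := ENNReal.tendsto_ofReal (t1.add t2)
  simp only [mul_zero, add_zero, ENNReal.ofReal_zero] at t3
  refine tendsto_of_tendsto_of_tendsto_of_le_of_le' tendsto_const_nhds t3
    (Eventually.of_forall fun n => zero_le) ?_
  filter_upwards [eventually_ge_atTop 1] with n hn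
  have hn' : (0 : ℝ) < n := by exact_mod_cast hn
  have hlog : 0 ≤ Real.log n := Real.log_natCast_nonneg n
  have hKn := lt_pow_numScales hρ hn
  set K := numScales ρ n
  have m1 := hZ.measure_gain_le hv hρ hKn (G := g * v * Real.log n) (by positivity)
  rw [hexp g n hn] at m1
  have m2 : P (⋃ p ∈ (A n).filter (· ≤ n),
      {ω | ¬ Tame (fun i => Z i ω) (δ * v * Real.log n) 0 n p}) ≤
      (A n).card * (K * (2 * (8 * ENNReal.ofReal ((n : ℝ) ^ (-(δ / (2 * ρ ^ 2))))))) := by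
    refine (measure_biUnion_le_card_mul _ _ _ fun p hp => ?_).trans (mul_le_mul_left
      (by exact_mod_cast Finset.card_filter_le (A n) (· ≤ n)) _)
    rw [← hexp δ n hn]
    exact hZ.measure_not_tame_le hv hρ hKn (by positivity) (Finset.mem_filter.1 hp).2
  have hsub : {ω | ¬ Typical (fun i => Z i ω) (g * v * Real.log n)
      (δ * v * Real.log n) n (A n)} ⊆
      {ω | ∃ a b c, a < b ∧ b < c ∧ c ≤ n ∧
        g * v * Real.log n < gain (fun i => Z i ω) a b c} ∪
      ⋃ p ∈ (A n).filter (· ≤ n),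
        {ω | ¬ Tame (fun i => Z i ω) (δ * v * Real.log n) 0 n p} := by
    intro ω hω
    by_contra hcon
    simp only [Set.mem_union, Set.mem_ofPred_eq, Set.mem_iUnion, Finset.mem_filter, not_or,
      not_exists, not_and, not_lt, not_not] at hcon hω
    exact hω ⟨hcon.1, fun p hp hpn => hcon.2 p ⟨hp, hpn⟩⟩
  refine (measure_mono hsub).trans ((measure_union_le _ _).trans ((add_le_add m1 m2).trans
    (le_of_eq ?_)))
  rw [ENNReal.ofReal_add (by positivity) (by positivity)]
  congr 1
  · have : (8 : ℝ) * ((K : ℝ) * K * (n : ℝ) ^ (-(g / (2 * ρ ^ 2) - 1))) =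
        n * (K * (K * (2 * (4 * (n : ℝ) ^ (-(g / (2 * ρ ^ 2))))))) := by
      rw [neg_sub, sub_eq_add_neg, Real.rpow_add hn', Real.rpow_one]
      ring
    rw [this]
    repeat rw [ENNReal.ofReal_mul (by positivity)]
    simp
  · have : (16 : ℝ) * (((A n).card : ℝ) * K * (n : ℝ) ^ (-(δ / (2 * ρ ^ 2)))) =
        (A n).card * (K * (2 * (8 * (n : ℝ) ^ (-(δ / (2 * ρ ^ 2)))))) := by ring
    rw [this]
    repeat rw [ENNReal.ofReal_mul (by positivity)]
    simp

/-- `HasLaw` gives only almost everywhere measurable variables. They are replaced by measurable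
versions, which almost surely agree for all indices at once. -/
lemma ChangeInMean.tendsto_not_typical [IsProbabilityMeasure P] {m : ℕ} {θ : Fin m → ℝ}
    {μ : Fin (m + 1) → ℝ} {v : ℝ≥0} {Z : ℕ → Ω → ℝ} (hM : ChangeInMean P θ μ v Z) {g δ : ℝ}
    (hg : 2 < g) (hδ : 0 < δ) (A : ℕ → Finset ℕ) (hA : SubPolynomial fun n => (A n).card) :
    Tendsto (fun n : ℕ => P {ω | ¬ Typical (fun i => Z i ω) (g * v * Real.log n)
      (δ * v * Real.log n) n (A n)}) atTop (𝓝 0) := by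
  set Z' : ℕ → Ω → ℝ := fun i => (hM.law i).aemeasurable.mk (Z i) with hZ'
  have hae : ∀ i, Z i =ᵐ[P] Z' i := fun i => (hM.law i).aemeasurable.ae_eq_mk
  have hN : IsNoise P v Z' :=
    ⟨fun i => (hM.law i).aemeasurable.measurable_mk, fun i => (hM.law i).congr (hae i).symm,
      hM.indep.congr hae⟩
  refine (hN.tendsto_not_typical hM.var_pos hg hδ A hA).congr fun n => measure_congr ?_
  filter_upwards [ae_all_iff.2 hae] with ω hω
  have : (fun i => Z i ω) = fun i => Z' i ω := funext hω
  change (¬ Typical _ _ _ _ _) = (¬ Typical _ _ _ _ _)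
  rw [this]

lemma tendsto_measure_one_of_typical [IsProbabilityMeasure P] {typ good : ℕ → Ω → Prop}
    (htyp : Tendsto (fun n => P {ω | ¬ typ n ω}) atTop (𝓝 0))
    (h : ∀ᶠ n in atTop, ∀ ω, typ n ω → good n ω) :
    Tendsto (fun n => P {ω | good n ω}) atTop (𝓝 1) := by
  have h1 : Tendsto (fun n => 1 - P {ω | ¬ typ n ω}) atTop (𝓝 1) := by
    simpa using ENNReal.Tendsto.sub (tendsto_const_nhds (x := (1 : ℝ≥0∞))) htyp
      (Or.inl ENNReal.one_ne_top)
  refine tendsto_of_tendsto_of_tendsto_of_le_of_le' h1 tendsto_const_nhds ?_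
    (Eventually.of_forall fun n => prob_le_one)
  filter_upwards [h] with n hn
  rw [tsub_le_iff_right]
  calc (1 : ℝ≥0∞) = P Set.univ := measure_univ.symm
    _ ≤ P ({ω | good n ω} ∪ {ω | ¬ typ n ω}) := measure_mono fun ω _ => by
        by_cases hb : typ n ω
        · exact Or.inl (hn ω hb)
        · exact Or.inr hb
    _ ≤ _ := measure_union_le _ _

end Noise

/-! ### Chunks and dealt points -/

lemma candidates_length (L : ℕ) (core : ℕ → Timed (List ℕ)) :
    (candidates L core).length = ∑ i ∈ Finset.Icc 1 L, (core i).val.length := by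
  induction L with
  | zero => simp [candidates]
  | succ L ih =>
    rw [Finset.sum_Icc_succ_top (by omega), ← ih]
    simp [candidates, List.range'_concat, add_comm]

lemma chunkLo_pred_le_chunkHi {n L : ℕ} (V i : ℕ) (hi : i ≤ L) :
    chunkLo n L V i - 1 ≤ chunkHi n L V i := by
  unfold chunkLo chunkHi
  have h1 : (i - 1) * (n / L) ≤ i * (n / L) := Nat.mul_le_mul_right _ (by omega)
  have h2 : i * (n / L) ≤ n := (Nat.mul_le_mul_right _ hi).trans (Nat.mul_div_le n L)
  split_ifs <;> omega

lemma chunkHi_le (n L V i : ℕ) : chunkHi n L V i ≤ n := by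
  unfold chunkHi
  split_ifs <;> omega

lemma chunkCore_isOptimal (y : ℕ → ℝ) (β : ℝ) {n L : ℕ} (V i : ℕ) (hi : i ≤ L) :
    IsOptimal y β (chunkLo n L V i - 1) (chunkHi n L V i)
      (Set.Ioo (chunkLo n L V i - 1) (chunkHi n L V i)) (chunkCore y β n L V i).val := by
  obtain ⟨h1, h2, h3⟩ := pelt_optimal y β (chunkLo_pred_le_chunkHi (n := n) V i hi)
    (B := chunkSet n L V i) List.pairwise_lt_range'
  refine ⟨h1, fun t ht => (h2 t ht).2, fun T' hT' hmem => h3 T' hT' fun t ht => ⟨?_, hmem t ht⟩⟩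
  have := hmem t ht
  rw [Set.mem_Ioo] at this
  rw [chunkSet, List.mem_range'_1]
  omega

/-- The chunks that contain a change at `t`. -/
def chunksAt (n L V t : ℕ) : Finset ℕ :=
  (Finset.Icc 1 L).filter fun i => chunkLo n L V i - 1 < t ∧ t < chunkHi n L V i

/-- Chunks whose indices differ by at least two start and end a full `n / L` apart before the
overlaps, and these extend them towards each other by at most `2 * V`. -/
lemma card_chunksAt_le {n L V t : ℕ} (hV : 2 * V ≤ n / L) : (chunksAt n L V t).card ≤ 2 := by
  have key : ∀ i ∈ chunksAt n L V t, ∀ i' ∈ chunksAt n L V t, i' ≤ i + 1 := by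
    intro i hi i' hi'
    by_contra! hlt
    rw [chunksAt, Finset.mem_filter, Finset.mem_Icc, chunkLo, chunkHi] at hi hi'
    have h1 : (i + 1) * (n / L) ≤ (i' - 1) * (n / L) := Nat.mul_le_mul_right _ (by omega)
    rw [add_mul] at h1
    have h2 : i ≠ L := by omega
    rw [if_neg h2] at hi
    omega
  rcases (chunksAt n L V t).eq_empty_or_nonempty with h | h
  · simp [h]
  · have hsub : chunksAt n L V t ⊆
        Finset.Icc ((chunksAt n L V t).min' h) ((chunksAt n L V t).min' h + 1) := by
      intro i hi
      rw [Finset.mem_Icc]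
      exact ⟨Finset.min'_le _ _ hi, key _ (Finset.min'_mem _ h) _ hi⟩
    refine (Finset.card_le_card hsub).trans ?_
    rw [Nat.card_Icc]
    omega

lemma chunkSet_length_le {n L V i : ℕ} (hi1 : 1 ≤ i) (hi : i ≤ L) (hV : 2 * V ≤ n / L) :
    (chunkSet n L V i).length ≤ n % L + 2 * (n / L) + 1 := by
  rw [chunkSet, List.length_range']
  obtain ⟨k, rfl⟩ := Nat.exists_eq_add_of_le' hi1
  have h1 : (k + 1) * (n / L) = k * (n / L) + n / L := by ring
  have h2 := Nat.div_add_mod n L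
  unfold chunkLo chunkHi
  rw [Nat.add_sub_cancel]
  split_ifs with h
  · subst h
    rw [h1] at h2
    omega
  · rw [h1]
    omega

lemma dealCore_isOptimal (y : ℕ → ℝ) (β : ℝ) (n L i : ℕ) :
    IsOptimal y β 0 n {t | t ∈ dealSet n L i ∧ 0 < t ∧ t < n} (dealCore y β n L i).val := by
  obtain ⟨h1, h2, h3⟩ := pelt_optimal y β (Nat.zero_le n)
    (B := dealSet n L i) ((List.pairwise_lt_range' (s := 1) (n := n - 1)).filter _)
  exact ⟨h1, h2, h3⟩

/-- Within one residue class modulo `L` a point is determined by its quotient. -/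
lemma dealSet_length_le (n L i : ℕ) : (dealSet n L i).length ≤ n / L + 1 := by
  have hnd : (dealSet n L i).Nodup := (List.nodup_range' (step := 1)).filter _
  rw [← List.toFinset_card_of_nodup hnd, ← Finset.card_range (n / L + 1)]
  have hmem : ∀ x, x ∈ (dealSet n L i).toFinset ↔ (1 ≤ x ∧ x < 1 + (n - 1)) ∧ x % L = i % L := by
    intro x
    simp [dealSet]
  refine Finset.card_le_card_of_injOn (fun x => x / L) ?_ ?_
  · intro x hx
    have := (hmem x).1 hx
    simp only [Finset.coe_range, Set.mem_Iio]
    exact Nat.lt_succ_of_le (Nat.div_le_div_right (by omega))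
  · intro x hx z hz h
    have h1 := (hmem x).1 hx
    have h2 := (hmem z).1 hz
    simp only at h
    rw [← Nat.div_add_mod x L, ← Nat.div_add_mod z L, h, h1.2, h2.2]

/-! ### The series -/

variable {Ω : Type*} {m : ℕ}

lemma series_noChange (θ : Fin m → ℝ) (μ : Fin (m + 1) → ℝ) (Z : ℕ → Ω → ℝ) (n : ℕ) (ω : Ω)
    (p q : ℕ) (h : NoChange (trueChange θ n) p q) :
    ∃ c, ∀ i ∈ Finset.Ioc p q, series θ μ Z n ω i = c + Z i ω := by
  refine ⟨μ (segIndex θ n (p + 1)), fun i hi => ?_⟩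
  rw [Finset.mem_Ioc] at hi
  unfold series
  congr 2
  unfold segIndex
  congr 2
  ext j
  simp only [Finset.mem_filter, Finset.mem_univ, true_and]
  rcases h j with h | h <;> omega

lemma segIndex_eq_castSucc {θ : Fin m → ℝ} {n Δ : ℕ} (hθ : StrictMono θ)
    (hsep : ∀ j j', θ j < θ j' → trueChange θ n j + 2 * Δ ≤ trueChange θ n j') {j : Fin m} {i : ℕ}
    (h1 : trueChange θ n j < i + Δ) (h2 : i ≤ trueChange θ n j) (hΔ : 0 < Δ) :
    segIndex θ n i = j.castSucc := by
  have : (Finset.univ.filter fun j' => trueChange θ n j' < i) = Finset.Iio j := by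
    ext j'
    simp only [Finset.mem_filter, Finset.mem_univ, true_and, Finset.mem_Iio]
    rcases lt_trichotomy j' j with h | rfl | h
    · have := hsep _ _ (hθ h); simp only [h, iff_true]; omega
    · simp only [lt_irrefl, iff_false]; omega
    · have := hsep _ _ (hθ h); simp only [h.le.not_gt, iff_false]; omega
  ext
  simp [segIndex, this]

lemma segIndex_eq_succ {θ : Fin m → ℝ} {n Δ : ℕ} (hθ : StrictMono θ)
    (hsep : ∀ j j', θ j < θ j' → trueChange θ n j + 2 * Δ ≤ trueChange θ n j') {j : Fin m} {i : ℕ}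
    (h1 : trueChange θ n j < i) (h2 : i ≤ trueChange θ n j + Δ) (hΔ : 0 < Δ) :
    segIndex θ n i = j.succ := by
  have : (Finset.univ.filter fun j' => trueChange θ n j' < i) = Finset.Iic j := by
    ext j'
    simp only [Finset.mem_filter, Finset.mem_univ, true_and, Finset.mem_Iic]
    rcases lt_trichotomy j' j with h | rfl | h
    · have := hsep _ _ (hθ h); simp only [h.le, iff_true]; omega
    · simp only [le_refl, iff_true]; omega
    · have := hsep _ _ (hθ h); simp only [h.not_ge, iff_false]; omega
  ext
  simp [segIndex, this]

/-- The gain at a change is of the order of the squared jump times the length. -/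
lemma lt_gain_of_jump {y W : ℕ → ℝ} {s Δ : ℕ} (hΔ : 0 < Δ) (hs : Δ ≤ s) {x z h c : ℝ}
    (hx : ∀ i ∈ Finset.Ioc (s - Δ) s, y i = x + W i)
    (hz : ∀ i ∈ Finset.Ioc s (s + Δ), y i = z + W i)
    (h1 : (∑ i ∈ Finset.Ioc (s - Δ) s, W i) ^ 2 ≤ h * Δ)
    (h2 : (∑ i ∈ Finset.Ioc s (s + Δ), W i) ^ 2 ≤ h * Δ)
    (hh : 16 * h ≤ (x - z) ^ 2 * Δ) (hc : 8 * c < (x - z) ^ 2 * Δ) :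
    c < gain y (s - Δ) s (s + Δ) := by
  have hΔ' : (0 : ℝ) < Δ := by exact_mod_cast hΔ
  have e1 : (s : ℝ) - ((s - Δ : ℕ) : ℝ) = Δ := by rw [Nat.cast_sub hs]; ring
  have e2 : ((s + Δ : ℕ) : ℝ) - s = Δ := by push_cast; ring
  rw [ParSpeed.gain_eq y (by omega) (by omega), e1, e2, Finset.sum_congr rfl hx,
    Finset.sum_congr rfl hz, Finset.sum_add_distrib, Finset.sum_add_distrib, Finset.sum_const,
    Finset.sum_const, Nat.card_Ioc, Nat.card_Ioc, Nat.sub_sub_self hs, Nat.add_sub_cancel_left]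
  set A := ∑ i ∈ Finset.Ioc (s - Δ) s, W i
  set B := ∑ i ∈ Finset.Ioc s (s + Δ), W i
  have e3 : ((Δ • x + A) / Δ - (Δ • z + B) / Δ) ^ 2 / (1 / (Δ : ℝ) + 1 / Δ) =
      ((x - z) * Δ + (A - B)) ^ 2 / (2 * Δ) := by
    rw [nsmul_eq_mul, nsmul_eq_mul]
    field_simp
    ring
  rw [e3, lt_div_iff₀ (by positivity)]
  -- The noise moves `(x - z) * Δ` by at most half of its size. A quarter of the square survives,
  -- and division by `2 * Δ` explains the constant `8` in `hc`.
  have e4 : 4 * (A - B) ^ 2 ≤ ((x - z) * Δ) ^ 2 := by nlinarith [sq_nonneg (A + B)]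
  nlinarith [sq_nonneg ((x - z) * Δ + 2 * (A - B))]

/-! ### Separation of the changes and control points for the noise -/

lemma eventually_log_le_mul (c d : ℝ) {γ : ℝ} (hγ : 0 < γ) :
    ∀ᶠ n : ℕ in atTop, c * Real.log n + d ≤ γ * n := by
  have h1 : (fun n : ℕ => c * Real.log n + d) =o[atTop] fun n : ℕ => (n : ℝ) := by
    refine IsLittleO.add ?_ ?_
    · exact (Real.isLittleO_log_id_atTop.comp_tendsto
        tendsto_natCast_atTop_atTop).const_mul_left c
    · refine isLittleO_const_left.2 (Or.inr ?_)
      exact tendsto_norm_atTop_atTop.comp tendsto_natCast_atTop_atTop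
  filter_upwards [h1.bound hγ] with n hn
  rw [Real.norm_eq_abs, Real.norm_eq_abs, Nat.abs_cast] at hn
  exact (le_abs_self _).trans hn

lemma eventually_trueChange_sep {θ : Fin m → ℝ} (h0 : ∀ j, 0 < θ j) (M : ℝ) :
    ∀ᶠ n : ℕ in atTop, ∀ j j', θ j < θ j' →
      trueChange θ n j + 2 * ⌈M * Real.log n⌉₊ ≤ trueChange θ n j' := by
  refine eventually_all.2 fun j => eventually_all.2 fun j' => ?_
  by_cases hlt : θ j < θ j'
  swap
  · exact Eventually.of_forall fun n h => absurd h hlt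
  filter_upwards [eventually_log_le_mul (2 * |M|) 2 (sub_pos.2 hlt)] with n hn _
  have hlog : 0 ≤ Real.log n := Real.log_natCast_nonneg n
  apply Nat.le_floor
  push_cast
  have h1 : (trueChange θ n j : ℝ) ≤ θ j * n :=
    Nat.floor_le (mul_nonneg (h0 j).le (Nat.cast_nonneg n))
  have h2 : (⌈M * Real.log n⌉₊ : ℝ) ≤ |M| * Real.log n + 1 := by
    refine le_trans ?_ (Nat.ceil_lt_add_one (mul_nonneg (abs_nonneg M) hlog)).le
    exact_mod_cast Nat.ceil_mono (mul_le_mul_of_nonneg_right (le_abs_self M) hlog)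
  linarith

lemma trueChange_mono {θ : Fin m → ℝ} (n : ℕ) {j j' : Fin m} (h : θ j ≤ θ j') :
    trueChange θ n j ≤ trueChange θ n j' :=
  Nat.floor_mono (mul_le_mul_of_nonneg_right h (Nat.cast_nonneg n))

/-- The points from which the cumulative sums of the noise are controlled: those near a change, and
the ends of the chunks that contain a change. -/
noncomputable def anchors (θ : Fin m → ℝ) (n L V Δ : ℕ) : Finset ℕ :=
  Finset.univ.biUnion fun j =>
    Finset.Icc (trueChange θ n j - Δ) (trueChange θ n j + Δ) ∪
      ((chunksAt n L V (trueChange θ n j)).image (fun i => chunkLo n L V i - 1) ∪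
        (chunksAt n L V (trueChange θ n j)).image (chunkHi n L V))

lemma card_anchors_le (θ : Fin m → ℝ) {n L V : ℕ} (Δ : ℕ) (hV : 2 * V ≤ n / L) :
    (anchors θ n L V Δ).card ≤ m * (2 * Δ + 5) := by
  refine Finset.card_biUnion_le.trans ?_
  calc _ ≤ ∑ _j : Fin m, (2 * Δ + 5) := Finset.sum_le_sum fun j _ => by
        have h := card_chunksAt_le (t := trueChange θ n j) hV
        have h1 := Finset.card_image_le (s := chunksAt n L V (trueChange θ n j))
          (f := fun i => chunkLo n L V i - 1)
        have h2 := Finset.card_image_le (s := chunksAt n L V (trueChange θ n j))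
          (f := chunkHi n L V)
        have h3 : (Finset.Icc (trueChange θ n j - Δ) (trueChange θ n j + Δ)).card ≤ 2 * Δ + 1 := by
          rw [Nat.card_Icc]; omega
        refine (Finset.card_union_le _ _).trans ?_
        have := Finset.card_union_le
          ((chunksAt n L V (trueChange θ n j)).image (fun i => chunkLo n L V i - 1))
          ((chunksAt n L V (trueChange θ n j)).image (chunkHi n L V))
        omega
    _ = _ := by simp

/-- Under typical noise, each core of Chunk returns at most as many candidates as there are changes
in its chunk. -/
lemma chunkCore_length_le {θ : Fin m → ℝ} {μ : Fin (m + 1) → ℝ} {Z : ℕ → Ω → ℝ} {n L V Δ : ℕ}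
    {ω : Ω} {β G h : ℝ} (hθ : StrictMono θ) (hh : 0 ≤ h) (hG : 0 ≤ G)
    (hβ : (m + 1) * (3 * h) + G < β) (hΔ : 0 < Δ)
    (hsep : ∀ j j', θ j < θ j' → trueChange θ n j + 2 * Δ ≤ trueChange θ n j')
    (hjump : ∀ j : Fin m, 16 * h ≤ (μ j.castSucc - μ j.succ) ^ 2 * Δ ∧
      8 * (3 * β) < (μ j.castSucc - μ j.succ) ^ 2 * Δ)
    (htyp : Typical (fun i => Z i ω) G h n (anchors θ n L V Δ)) {i : ℕ}
    (hi : i ∈ Finset.Icc 1 L) :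
    (chunkCore (series θ μ Z n ω) β n L V i).val.length ≤
      (Finset.univ.filter fun j => chunkLo n L V i - 1 < trueChange θ n j ∧
        trueChange θ n j < chunkHi n L V i).card := by
  have hn := chunkHi_le n L V i
  have hmem : ∀ (j : Fin m) (p : ℕ), trueChange θ n j ≤ p + Δ → p ≤ trueChange θ n j + Δ →
      p ∈ anchors θ n L V Δ := fun j p h1 h2 =>
    Finset.mem_biUnion.2 ⟨j, Finset.mem_univ _, Finset.mem_union_left _
      (Finset.mem_Icc.2 ⟨by omega, h2⟩)⟩
  refine (chunkCore_isOptimal (series θ μ Z n ω) β V i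
    (Finset.mem_Icc.1 hi).2).length_le_card (W := fun i => Z i ω) (h := h) (G := G) (Δ := Δ)
    (fun p q hpq => series_noChange θ μ Z n ω p q hpq) hh hG hβ
    (fun p t q _ h1 h2 h3 => htyp.1 p t q h1 h2 (h3.trans hn)) hΔ ?_ ?_ ?_ ?_
  · intro j j' hjj
    refine hsep j j' ?_
    by_contra! hle
    exact absurd (trueChange_mono n hle) (by omega)
  · intro j h1 h2
    have hc : i ∈ chunksAt n L V (trueChange θ n j) := Finset.mem_filter.2 ⟨hi, h1, h2⟩
    have ha : chunkLo n L V i - 1 ∈ anchors θ n L V Δ :=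
      Finset.mem_biUnion.2 ⟨j, Finset.mem_univ _, Finset.mem_union_right _
        (Finset.mem_union_left _ (Finset.mem_image_of_mem (fun i => chunkLo n L V i - 1) hc))⟩
    have he : chunkHi n L V i ∈ anchors θ n L V Δ :=
      Finset.mem_biUnion.2 ⟨j, Finset.mem_univ _, Finset.mem_union_right _
        (Finset.mem_union_right _ (Finset.mem_image_of_mem _ hc))⟩
    exact ⟨(htyp.2 _ ha (by omega)).mono (Nat.zero_le _) hn,
      (htyp.2 _ he hn).mono (Nat.zero_le _) hn⟩
  · intro j p _ h2 h3 h4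
    exact (htyp.2 p (hmem j p h3 h4) (h2.trans hn)).mono (Nat.zero_le _) hn
  · intro j h1 h2
    have ht := htyp.2 _ (hmem j (trueChange θ n j) (by omega) (by omega)) (by omega)
    have e1 := ht.2 (trueChange θ n j - Δ) (Nat.zero_le _) (by omega)
    have e2 := ht.1 (trueChange θ n j + Δ) (by omega) (by omega)
    rw [Nat.cast_sub h1.le, sub_sub_cancel] at e1
    rw [Nat.cast_add, add_sub_cancel_left] at e2
    refine lt_gain_of_jump hΔ h1.le (x := μ j.castSucc) (z := μ j.succ) ?_ ?_ e1 e2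
      (hjump j).1 (hjump j).2
    · intro i hi
      rw [Finset.mem_Ioc] at hi
      rw [series, segIndex_eq_castSucc hθ hsep (by omega) hi.2 hΔ]
    · intro i hi
      rw [Finset.mem_Ioc] at hi
      rw [series, segIndex_eq_succ hθ hsep hi.1 hi.2 hΔ]

/-- Double counting of the pairs of a chunk and a change inside it: at most two chunks for each
change. -/
lemma candidates_chunk_length_le {τ : Fin m → ℕ} {n L V : ℕ} (hV : 2 * V ≤ n / L)
    {core : ℕ → Timed (List ℕ)}
    (h : ∀ i ∈ Finset.Icc 1 L, (core i).val.length ≤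
      (Finset.univ.filter fun j => chunkLo n L V i - 1 < τ j ∧ τ j < chunkHi n L V i).card) :
    (candidates L core).length ≤ 2 * m := by
  rw [candidates_length]
  calc _ ≤ ∑ i ∈ Finset.Icc 1 L, (Finset.univ.filter fun j =>
        chunkLo n L V i - 1 < τ j ∧ τ j < chunkHi n L V i).card := Finset.sum_le_sum h
    _ = ∑ j : Fin m, (chunksAt n L V (τ j)).card := by
      simp only [Finset.card_filter, chunksAt]
      rw [Finset.sum_comm]
    _ ≤ ∑ _j : Fin m, 2 := Finset.sum_le_sum fun j _ => card_chunksAt_le hV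
    _ = 2 * m := by simp [mul_comm]

lemma eventually_log_pos : ∀ᶠ n : ℕ in atTop, 0 < Real.log n := by
  filter_upwards [eventually_gt_atTop 1] with n hn
  exact Real.log_pos (by exact_mod_cast hn)

lemma eventually_le_of_isLittleO {L : ℕ → ℕ}
    (hL : (fun n => (L n : ℝ)) =o[atTop] fun n : ℕ => (n : ℝ)) : ∀ᶠ n in atTop, L n ≤ n := by
  filter_upwards [hL.bound one_pos] with n hn
  simpa using hn

/-! ### Numbers of candidates with high probability -/

variable [MeasurableSpace Ω]

/-- With probability tending to one, all cores of Chunk together return at most `2 m` candidates. -/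
lemma tendsto_chunk_candidates (P : Measure Ω) [IsProbabilityMeasure P]
    (θ : Fin m → ℝ) (μ : Fin (m + 1) → ℝ) (v : ℝ≥0) (Z : ℕ → Ω → ℝ) (ε : ℝ) (L V : ℕ → ℕ)
    (hM : ChangeInMean P θ μ v Z) (hε : 0 < ε) (hV : ∀ᶠ n in atTop, 2 * V n ≤ n / L n) :
    Tendsto (fun n => P {ω |
      (candidates (L n) (chunkCore (series θ μ Z n ω)
        (penalty ε v n) n (L n) (V n))).length ≤ 2 * m}) atTop (𝓝 1) := by
  have hv : (0 : ℝ) < v := by exact_mod_cast hM.var_pos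
  set d : Fin m → ℝ := fun j => (μ j.castSucc - μ j.succ) ^ 2 with hd
  have hd0 : ∀ j, 0 < d j := fun j => by
    have := sub_ne_zero.2 (hM.jump j)
    positivity
  -- The tame losses must fit between `G` and the penalty: in units of `σ² log n`, they take at most
  -- `ε / 4` of the margin `ε / 2` left by `g = 2 + ε / 2`.
  set δ : ℝ := min 1 (ε / (12 * (m + 1))) with hδdef
  have hδ : 0 < δ := lt_min one_pos (by positivity)
  have hδ1 : δ ≤ 1 := min_le_left _ _
  have hδ2 : (m + 1) * (3 * δ) ≤ ε / 4 := by
    have : δ ≤ ε / (12 * (m + 1)) := min_le_right _ _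
    rw [le_div_iff₀ (by positivity)] at this
    linarith
  -- Makes `Δ` times each squared jump at least `30` penalties, above the `24 = 8 * 3` needed at a
  -- change and ample for `16 * h`. The sum serves as a maximum over the changes; the summand `1`
  -- keeps `Δ` positive when `m = 0`.
  set M : ℝ := 1 + ∑ j, 30 * ((2 + ε) * v) / d j with hMdef
  have hMd : ∀ j, 30 * ((2 + ε) * v) ≤ d j * M := by
    intro j
    have h1 : 30 * ((2 + ε) * v) / d j ≤ M := by
      have := Finset.single_le_sum (f := fun j => 30 * ((2 + ε) * v) / d j)
        (fun j _ => by have := hd0 j; positivity) (Finset.mem_univ j)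
      linarith
    rwa [div_le_iff₀' (hd0 j)] at h1
  have hM0 : 0 < M := by
    have : 0 ≤ ∑ j, 30 * ((2 + ε) * v) / d j :=
      Finset.sum_nonneg fun j _ => by have := hd0 j; positivity
    linarith
  set Δ : ℕ → ℕ := fun n => ⌈M * Real.log n⌉₊ with hΔ
  have hA : SubPolynomial fun n => (anchors θ n (L n) (V n) (Δ n)).card := by
    refine subPolynomial_of_le_log (c := m * (2 * M)) (d := m * 7) ?_
    filter_upwards [hV] with n hn
    have h1 : (Δ n : ℝ) ≤ M * Real.log n + 1 :=
      (Nat.ceil_lt_add_one (mul_nonneg hM0.le (Real.log_natCast_nonneg n))).le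
    have h2 : ((anchors θ n (L n) (V n) (Δ n)).card : ℝ) ≤ m * (2 * Δ n + 5) := by
      exact_mod_cast card_anchors_le θ (Δ n) hn
    calc _ ≤ (m : ℝ) * (2 * Δ n + 5) := h2
      _ ≤ m * (2 * (M * Real.log n + 1) + 5) := by gcongr
      _ = _ := by ring
  refine tendsto_measure_one_of_typical
    (hM.tendsto_not_typical (g := 2 + ε / 2) (by linarith) hδ _ hA) ?_
  filter_upwards [hV, eventually_log_pos,
    eventually_trueChange_sep (fun j => (hM.mem_Ioo j).1) M] with n hVn hlog hsep ω htyp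
  have hMΔ : M * Real.log n ≤ Δ n := Nat.le_ceil _
  refine candidates_chunk_length_le hVn fun i hi => chunkCore_length_le hM.strictMono
    (by positivity) (by positivity) ?_ (Nat.ceil_pos.2 (by positivity)) hsep (fun j => ?_) htyp hi
  · rw [penalty]
    have : 0 < v * Real.log n := by positivity
    nlinarith
  · have h1 : 30 * ((2 + ε) * v) * Real.log n ≤ d j * Δ n :=
      calc _ ≤ d j * M * Real.log n := mul_le_mul_of_nonneg_right (hMd j) hlog.le
        _ ≤ _ := by rw [mul_assoc]; have := (hd0 j).le; gcongr
    have h2 : 0 < v * Real.log n := by positivity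
    have h3 : 0 < ε * (v * Real.log n) := by positivity
    have h4 : δ * (v * Real.log n) ≤ 1 * (v * Real.log n) := by gcongr
    rw [penalty]
    constructor
    · change _ ≤ d j * _
      linarith
    · change _ < d j * _
      linarith

/-- With probability tending to one, every core of Deal returns at most `2 m` candidates. -/
lemma tendsto_deal_candidates (P : Measure Ω) [IsProbabilityMeasure P]
    (θ : Fin m → ℝ) (μ : Fin (m + 1) → ℝ) (v : ℝ≥0) (Z : ℕ → Ω → ℝ) (ε : ℝ) (L : ℕ → ℕ)
    (hM : ChangeInMean P θ μ v Z) (hε : 0 < ε) :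
    Tendsto (fun n => P {ω | ∀ i ∈ Finset.Icc 1 (L n),
      (dealCore (series θ μ Z n ω) (penalty ε v n) n (L n) i).val.length ≤ 2 * m})
      atTop (𝓝 1) := by
  have hv : (0 : ℝ) < v := by exact_mod_cast hM.var_pos
  have hA : SubPolynomial fun _ => ((∅ : Finset ℕ).card : ℝ) := by
    intro η _
    exact Eventually.of_forall fun n => by
      rw [Finset.card_empty, Nat.cast_zero]; positivity
  -- No tame points are needed here, so the set of anchors is empty and `δ = 1` is arbitrary. The
  -- one event about gains serves all cores.
  refine tendsto_measure_one_of_typical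
    (hM.tendsto_not_typical (g := 2 + ε / 2) (by linarith) one_pos _ hA) ?_
  filter_upwards [eventually_log_pos] with n hlog ω htyp i _
  refine (dealCore_isOptimal (series θ μ Z n ω) (penalty ε v n) n (L n) i).length_le_two_mul
    (τ := trueChange θ n) (fun t ht => ht.2) fun p t q _ h1 h2 h3 hpq => ?_
  rw [hpq.gain_eq (fun p q => series_noChange θ μ Z n ω p q) h1.le h2.le]
  refine (htyp.1 p t q h1 h2 h3).trans_lt ?_
  rw [penalty]
  have : 0 < v * Real.log n := by positivity
  nlinarith

/-! ### Costs of the two procedures -/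

/-- `L ≤ n` makes `n / L ≥ 1`, which absorbs additive constants. A chunk has at most `|K| * (n / L)`
left-over points, `2 * (n / L)` from its block and overlaps, and a constant. The merge phase on at
most `2 * m` candidates is quadratic in `m`. -/
lemma chunk_steps_le (y : ℕ → ℝ) (β K : ℝ) {n L V m : ℕ} (hL : 1 ≤ L) (hLn : L ≤ n)
    (hV : 2 * V ≤ n / L) (hK : ((n % L : ℕ) : ℝ) ≤ K * ((n : ℝ) / L))
    (hc : (candidates L (chunkCore y β n L V)).length ≤ 2 * m) :
    ((chunk y β n L V).steps : ℝ) ≤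
      (8 * (|K| + 4) ^ 2 + 100) * max (((n : ℝ) / L) ^ 2) ((m : ℝ) ^ 2) := by
  have hL' : (0 : ℝ) < L := by exact_mod_cast hL
  set x := (n : ℝ) / L with hx
  have hx1 : 1 ≤ x := by
    rw [hx, one_le_div hL']; exact_mod_cast hLn
  have hq : ((n / L : ℕ) : ℝ) ≤ x := Nat.cast_div_le
  have hsteps := parallelise_steps_le y β n L (chunkCore y β n L V)
    (8 * (n % L + 2 * (n / L) + 2) ^ 2) fun i hi => by
      rw [Finset.mem_Icc] at hi
      refine (pelt_steps_le _ _ _ _ _).trans ?_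
      have := chunkSet_length_le hi.1 hi.2 hV
      gcongr 8 * ?_ ^ 2
      omega
  have h1 : ((chunk y β n L V).steps : ℝ) ≤
      8 * (((n % L : ℕ) : ℝ) + 2 * ((n / L : ℕ) : ℝ) + 2) ^ 2 +
      10 * (((candidates L (chunkCore y β n L V)).length : ℝ) + 1) ^ 2 := by
    exact_mod_cast hsteps
  have h2 : ((candidates L (chunkCore y β n L V)).length : ℝ) ≤ 2 * m := by exact_mod_cast hc
  have hKx : K * x ≤ |K| * x := by gcongr; exact le_abs_self K
  have h3 : ((n % L : ℕ) : ℝ) + 2 * ((n / L : ℕ) : ℝ) + 2 ≤ (|K| + 4) * x := by linarith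
  have h4 : x ^ 2 ≤ max (x ^ 2) ((m : ℝ) ^ 2) := le_max_left _ _
  have h5 : (m : ℝ) ^ 2 ≤ max (x ^ 2) ((m : ℝ) ^ 2) := le_max_right _ _
  have h6 : 1 ≤ x ^ 2 := one_le_pow₀ hx1
  calc _ ≤ 8 * ((|K| + 4) * x) ^ 2 + 10 * (2 * (m : ℝ) + 1) ^ 2 := by
        refine h1.trans ?_
        gcongr
    _ ≤ 8 * (|K| + 4) ^ 2 * x ^ 2 + 100 * max (x ^ 2) ((m : ℝ) ^ 2) := by
        have h7 : 10 * (2 * (m : ℝ) + 1) ^ 2 ≤ 60 * (m : ℝ) ^ 2 + 30 := by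
          nlinarith only [sq_nonneg ((m : ℝ) - 1)]
        rw [mul_pow, ← mul_assoc]
        linarith only [h4, h5, h6, h7]
    _ ≤ 8 * (|K| + 4) ^ 2 * max (x ^ 2) ((m : ℝ) ^ 2) + 100 * max (x ^ 2) ((m : ℝ) ^ 2) := by
        gcongr
    _ = _ := by ring

/-- The split phase is quadratic in `n / L`. The parent may receive `2 * m` candidates from each of
`L` cores, hence the term `L ^ 2` with a constant depending on `m`. -/
lemma deal_steps_le (y : ℕ → ℝ) (β : ℝ) {n L m : ℕ} (hL : 1 ≤ L) (hLn : L ≤ n)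
    (hc : ∀ i ∈ Finset.Icc 1 L, (dealCore y β n L i).val.length ≤ 2 * m) :
    ((deal y β n L).steps : ℝ) ≤
      (72 + 10 * (2 * m + 1) ^ 2) * max (((n : ℝ) / L) ^ 2) ((L : ℝ) ^ 2) := by
  have hL' : (0 : ℝ) < L := by exact_mod_cast hL
  have hL1 : (1 : ℝ) ≤ L := by exact_mod_cast hL
  set x := (n : ℝ) / L with hx
  have hx1 : 1 ≤ x := by
    rw [hx, one_le_div hL']; exact_mod_cast hLn
  have hq : ((n / L : ℕ) : ℝ) ≤ x := Nat.cast_div_le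
  have hsteps := parallelise_steps_le y β n L (dealCore y β n L)
    (8 * (n / L + 2) ^ 2) fun i hi => by
      refine (pelt_steps_le _ _ _ _ _).trans ?_
      have := dealSet_length_le n L i
      gcongr 8 * ?_ ^ 2
      omega
  have hcand : (candidates L (dealCore y β n L)).length ≤ L * (2 * m) := by
    rw [candidates_length]
    refine (Finset.sum_le_sum hc).trans ?_
    simp
  have h1 : ((deal y β n L).steps : ℝ) ≤
      8 * (((n / L : ℕ) : ℝ) + 2) ^ 2 +
      10 * (((candidates L (dealCore y β n L)).length : ℝ) + 1) ^ 2 := by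
    exact_mod_cast hsteps
  have h2 : ((candidates L (dealCore y β n L)).length : ℝ) ≤ L * (2 * m) := by
    exact_mod_cast hcand
  calc _ ≤ 8 * (3 * x) ^ 2 + 10 * ((2 * m + 1) * (L : ℝ)) ^ 2 := by
        refine h1.trans ?_
        gcongr <;> linarith
    _ = 72 * x ^ 2 + 10 * (2 * m + 1) ^ 2 * (L : ℝ) ^ 2 := by ring
    _ ≤ 72 * max (x ^ 2) ((L : ℝ) ^ 2) + 10 * (2 * m + 1) ^ 2 * max (x ^ 2) ((L : ℝ) ^ 2) := by
        gcongr
        · exact le_max_left _ _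
        · exact le_max_right _ _
    _ = _ := by ring

lemma tendsto_measure_one_mono {P : Measure Ω} [IsProbabilityMeasure P] {p q : ℕ → Ω → Prop}
    (hp : Tendsto (fun n => P {ω | p n ω}) atTop (𝓝 1))
    (h : ∀ᶠ n in atTop, ∀ ω, p n ω → q n ω) :
    Tendsto (fun n => P {ω | q n ω}) atTop (𝓝 1) :=
  tendsto_of_tendsto_of_tendsto_of_le_of_le' hp tendsto_const_nhds
    (h.mono fun _ hn => measure_mono hn) (Eventually.of_forall fun _ => prob_le_one)

end ParSpeed

theorem corollary1 :
    -- Chunk: all cores together return at most `2m` candidates.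
    (∀ {Ω : Type*} [MeasurableSpace Ω] (P : Measure Ω) [IsProbabilityMeasure P]
        (m : ℕ) (θ : Fin m → ℝ) (μ : Fin (m + 1) → ℝ) (v : ℝ≥0) (Z : ℕ → Ω → ℝ)
        (ε : ℝ) (L V : ℕ → ℕ),
        ParSpeed.ChangeInMean P θ μ v Z → 0 < ε →
        (∀ᶠ n in atTop, 1 ≤ L n) →
        (fun n => (L n : ℝ)) =o[atTop] (fun n : ℕ => (n : ℝ)) →
        (∀ᶠ n in atTop, 2 * V n ≤ n / L n) →
        Tendsto (fun n => P {ω |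
          (ParSpeed.candidates (L n) (ParSpeed.chunkCore (ParSpeed.series θ μ Z n ω)
            (ParSpeed.penalty ε v n) n (L n) (V n))).length ≤ 2 * m}) atTop (𝓝 1)) ∧
    -- Chunk: the cost, if the points left over for the last core are `O(n / L(n))`.
    (∀ K : ℝ, ∃ C : ℝ, ∀ {Ω : Type*} [MeasurableSpace Ω] (P : Measure Ω) [IsProbabilityMeasure P]
        (m : ℕ) (θ : Fin m → ℝ) (μ : Fin (m + 1) → ℝ) (v : ℝ≥0) (Z : ℕ → Ω → ℝ)
        (ε : ℝ) (L V : ℕ → ℕ),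
        ParSpeed.ChangeInMean P θ μ v Z → 0 < ε →
        (∀ᶠ n in atTop, 1 ≤ L n) →
        (fun n => (L n : ℝ)) =o[atTop] (fun n : ℕ => (n : ℝ)) →
        (∀ᶠ n in atTop, 2 * V n ≤ n / L n) →
        (∀ᶠ n in atTop, ((n % L n : ℕ) : ℝ) ≤ K * ((n : ℝ) / L n)) →
        Tendsto (fun n => P {ω |
          ((ParSpeed.chunk (ParSpeed.series θ μ Z n ω)
            (ParSpeed.penalty ε v n) n (L n) (V n)).steps : ℝ)
              ≤ C * max (((n : ℝ) / L n) ^ 2) ((m : ℝ) ^ 2)}) atTop (𝓝 1)) ∧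
    -- Deal: every core returns at most `2m` candidates.
    (∀ {Ω : Type*} [MeasurableSpace Ω] (P : Measure Ω) [IsProbabilityMeasure P]
        (m : ℕ) (θ : Fin m → ℝ) (μ : Fin (m + 1) → ℝ) (v : ℝ≥0) (Z : ℕ → Ω → ℝ)
        (ε α : ℝ) (L : ℕ → ℕ),
        ParSpeed.ChangeInMean P θ μ v Z → 0 < ε → 0 < α →
        (fun n => (L n : ℝ)) =o[atTop] (fun n : ℕ => (n : ℝ)) →
        (∀ᶠ n : ℕ in atTop, ⌈Real.log n ^ (1 + α)⌉₊ ≤ L n) →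
        Tendsto (fun n => P {ω | ∀ i ∈ Finset.Icc 1 (L n),
          (ParSpeed.dealCore (ParSpeed.series θ μ Z n ω)
            (ParSpeed.penalty ε v n) n (L n) i).val.length ≤ 2 * m}) atTop (𝓝 1)) ∧
    -- Deal: the cost.
    (∀ m : ℕ, ∃ C : ℝ, ∀ {Ω : Type*} [MeasurableSpace Ω] (P : Measure Ω) [IsProbabilityMeasure P]
        (θ : Fin m → ℝ) (μ : Fin (m + 1) → ℝ) (v : ℝ≥0) (Z : ℕ → Ω → ℝ)
        (ε α : ℝ) (L : ℕ → ℕ),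
        ParSpeed.ChangeInMean P θ μ v Z → 0 < ε → 0 < α →
        (fun n => (L n : ℝ)) =o[atTop] (fun n : ℕ => (n : ℝ)) →
        (∀ᶠ n : ℕ in atTop, ⌈Real.log n ^ (1 + α)⌉₊ ≤ L n) →
        Tendsto (fun n => P {ω |
          ((ParSpeed.deal (ParSpeed.series θ μ Z n ω)
            (ParSpeed.penalty ε v n) n (L n)).steps : ℝ)
              ≤ C * max (((n : ℝ) / L n) ^ 2) ((L n : ℝ) ^ 2)}) atTop (𝓝 1)) ∧
    -- PELT without parallelisation.
    (∃ C : ℝ, ∀ (y : ℕ → ℝ) (β : ℝ) (n : ℕ), 1 ≤ n →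
        ((ParSpeed.plainPelt y β n).steps : ℝ) ≤ C * (n : ℝ) ^ 2) := by
  refine ⟨?_, fun K => ⟨8 * (|K| + 4) ^ 2 + 100, ?_⟩, ?_,
    fun m => ⟨72 + 10 * (2 * m + 1) ^ 2, ?_⟩, 8, fun y β n hn => ParSpeed.plainPelt_steps_le y β n hn⟩
  · intro Ω _ P _ m θ μ v Z ε L V hM hε _ _ hV
    exact ParSpeed.tendsto_chunk_candidates P θ μ v Z ε L V hM hε hV
  · intro Ω _ P _ m θ μ v Z ε L V hM hε hL hLo hV hK
    refine ParSpeed.tendsto_measure_one_mono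
      (ParSpeed.tendsto_chunk_candidates P θ μ v Z ε L V hM hε hV) ?_
    filter_upwards [hL, ParSpeed.eventually_le_of_isLittleO hLo, hV, hK] with n h1 h2 h3 h4 ω hω
    exact ParSpeed.chunk_steps_le _ _ K h1 h2 h3 h4 hω
  · intro Ω _ P _ m θ μ v Z ε α L hM hε _ _ _
    exact ParSpeed.tendsto_deal_candidates P θ μ v Z ε L hM hε
  · intro Ω _ P _ θ μ v Z ε α L hM hε _ hLo hL
    refine ParSpeed.tendsto_measure_one_mono
      (ParSpeed.tendsto_deal_candidates P θ μ v Z ε L hM hε) ?_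
    filter_upwards [hL, ParSpeed.eventually_le_of_isLittleO hLo, ParSpeed.eventually_log_pos]
      with n h1 h2 h3 ω hω
    -- The lower bound on `L n` enters only through `1 ≤ L n`, valid as soon as `log n` is positive.
    exact ParSpeed.deal_steps_le _ _
      ((Nat.one_le_ceil_iff.2 (Real.rpow_pos_of_pos h3 _)).trans h1) h2 hω
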